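/- Let $p$ be a prime and let $G$ be a finite $p$-group. For $x\in G$ let $\mathrm{ebr}(x)$ be the integer with $[G:C_G(x)]=p^{\mathrm{ebr}(x)}$, and for a subgroup $H\le G$ let $\mathrm{sbr}(H)$ be the integer with $[G:N_G(H)]=p^{\mathrm{sbr}(H)}$. Let $\mathrm{ebr}(G)=\max_{x\in G}\mathrm{ebr}(x)$ (the element breadth) and $\mathrm{sbr}(G)=\max_{H\le G}\mathrm{sbr}(H)$ (the subgroup breadth). Suppose that $\mathrm{ebr}(G)=\mathrm{sbr}(G)=1$. Then $[G:Z(G)]=p^2$, unless $p=2$ and, for some $n\ge 0$, $G$ is isomorphic to one of the following groups, for which $[G:Z(G)]\neq p^2$: 1. $(\mathbb{Z}_2)^n\times (Q_8 * D_8)$, 2. $(\mathbb{Z}_2)^n\times (Q_8 * P_{2,1,1})$. Here $Q_8$ and $D_8$ are the quaternion group and the dihedral group of order $8$, $$P_{2,1,1}=\langle a,b,c \mid a^4=b^2=c^2=1,\ [a,b]=[b,c]=1,\ [a,c]=b\rangle,$$ and $A*B$ denotes the central product of $A$ and $B$ in which the derived subgroups $A'$ and $B'$ (central of order $2$ in each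 of these cases) are identified, that is, $A*B=(A\times B)/\{(x,\theta(x)^{-1}) : x\in A'\}$ for the isomorphism $\theta:A'\to B'$. -/

import Mathlib

open scoped commutatorElement

/-- The element breadth `ebr(x)` of an element `x` of a finite `p`-group `G`: the integer with
`[G : C_G(x)] = p ^ ebr(x)`. -/
noncomputable def ebrElem (p : ℕ) {G : Type*} [Group G] (x : G) : ℕ :=
  Nat.log p (Subgroup.centralizer {x}).index

/-- The element breadth `ebr(G)` of a finite `p`-group `G`: the maximum of `ebr(x)`, `x ∈ G`. -/
noncomputable def ebr (p : ℕ) (G : Type*) [Group G] : ℕ :=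
  ⨆ x : G, ebrElem p x

/-- The subgroup breadth `sbr(H)` of a subgroup `H` of a finite `p`-group `G`: the integer with
`[G : N_G(H)] = p ^ sbr(H)`. -/
noncomputable def sbrSubgroup (p : ℕ) {G : Type*} [Group G] (H : Subgroup G) : ℕ :=
  Nat.log p (Subgroup.normalizer (H : Set G)).index

/-- The subgroup breadth `sbr(G)` of a finite `p`-group `G`: the maximum of `sbr(H)` over all
subgroups `H` of `G`. -/
noncomputable def sbr (p : ℕ) (G : Type*) [Group G] : ℕ :=
  ⨆ H : Subgroup G, sbrSubgroup p H

theorem index_centralizer_eq_pow_ebrElem {p : ℕ} [hp : Fact p.Prime] {G : Type*} [Group G]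
    [Finite G] (hG : IsPGroup p G) (x : G) :
    (Subgroup.centralizer {x}).index = p ^ ebrElem p x := by
  obtain ⟨n, hn⟩ := hG.index (Subgroup.centralizer {x})
  rw [ebrElem, hn, Nat.log_pow hp.out.one_lt]

theorem index_normalizer_eq_pow_sbrSubgroup {p : ℕ} [hp : Fact p.Prime] {G : Type*} [Group G]
    [Finite G] (hG : IsPGroup p G) (H : Subgroup G) :
    (Subgroup.normalizer (H : Set G)).index = p ^ sbrSubgroup p H := by
  obtain ⟨n, hn⟩ := hG.index (Subgroup.normalizer (H : Set G))
  rw [sbrSubgroup, hn, Nat.log_pow hp.out.one_lt]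

theorem isGreatest_ebr (p : ℕ) (G : Type*) [Group G] [Finite G] :
    IsGreatest (Set.range fun x : G => ebrElem p x) (ebr p G) :=
  ⟨Nat.sSup_mem (Set.range_nonempty _) (Set.finite_range _).bddAbove,
    fun _ h => le_csSup (Set.finite_range _).bddAbove h⟩

theorem isGreatest_sbr (p : ℕ) (G : Type*) [Group G] [Finite G] :
    IsGreatest (Set.range fun H : Subgroup G => sbrSubgroup p H) (sbr p G) :=
  ⟨Nat.sSup_mem (Set.range_nonempty _) (Set.finite_range _).bddAbove,
    fun _ h => le_csSup (Set.finite_range _).bddAbove h⟩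

/-- The subgroup of `A × B` that is factored out in the central product. When `A'` and `B'` are
central it consists exactly of the pairs `(x, θ(x)⁻¹)`, `x ∈ A'`; see
`mem_centralProductKernel_iff`. -/
def centralProductKernel {A B : Type*} [Group A] [Group B]
    (θ : commutator A ≃* commutator B) : Subgroup (A × B) :=
  Subgroup.normalClosure (Set.range fun x : commutator A => ((x : A), ((θ x)⁻¹ : B)))

instance {A B : Type*} [Group A] [Group B] (θ : commutator A ≃* commutator B) :
    (centralProductKernel θ).Normal :=
  Subgroup.normalClosure_normal

/-- The central product `A * B` of two groups whose derived subgroups are central and isomorphic,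
with the derived subgroups identified along the isomorphism `θ : A' ≃ B'`. -/
abbrev CentralProduct (A B : Type*) [Group A] [Group B]
    (θ : commutator A ≃* commutator B) : Type _ :=
  (A × B) ⧸ centralProductKernel θ

theorem mem_centralProductKernel_iff {A B : Type*} [Group A] [Group B]
    (θ : commutator A ≃* commutator B) (hA : commutator A ≤ Subgroup.center A)
    (hB : commutator B ≤ Subgroup.center B) (y : A × B) :
    y ∈ centralProductKernel θ ↔ ∃ x : commutator A, y = ((x : A), ((θ x)⁻¹ : B)) := by
  constructor
  · intro h
    let S : Subgroup (A × B) :=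
      { carrier := {y | ∃ x : commutator A, y = ((x : A), ((θ x)⁻¹ : B))}
        one_mem' := ⟨1, by simp [Prod.one_eq_mk]⟩
        mul_mem' := by
          rintro _ _ ⟨x, rfl⟩ ⟨x', rfl⟩
          refine ⟨x * x', Prod.ext (by simp) ?_⟩
          have := Subgroup.mem_center_iff.1 (hB (θ x').2) (θ x)
          simp only [Prod.mk_mul_mk, map_mul, Subgroup.coe_mul]
          rw [← mul_inv_rev, this]
        inv_mem' := by
          rintro _ ⟨x, rfl⟩
          exact ⟨x⁻¹, by simp⟩ }
    have hS : S.Normal := by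
      constructor
      rintro _ ⟨x, rfl⟩ ⟨g, k⟩
      refine ⟨x, Prod.ext ?_ ?_⟩
      · have := Subgroup.mem_center_iff.1 (hA x.2) g
        simp [this]
      · have := Subgroup.mem_center_iff.1 ((Subgroup.center B).inv_mem (hB (θ x).2)) k
        simp [this]
    have hle : centralProductKernel θ ≤ S :=
      Subgroup.normalClosure_le_normal (by rintro _ ⟨x, rfl⟩; exact ⟨x, rfl⟩)
    exact hle h
  · rintro ⟨x, rfl⟩
    exact Subgroup.subset_normalClosure ⟨x, rfl⟩

/-- The defining relators of `P_{i,1,k}`, in generators `a`, `b`, `c` numbered `0`, `1`, `2`. -/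
def relatorsP (p i k : ℕ) : Set (FreeGroup (Fin 3)) :=
  let a : FreeGroup (Fin 3) := FreeGroup.of 0
  let b : FreeGroup (Fin 3) := FreeGroup.of 1
  let c : FreeGroup (Fin 3) := FreeGroup.of 2
  {a ^ p ^ i, b ^ p, c ^ p ^ k, ⁅a, b⁆, ⁅b, c⁆, ⁅a, c⁆ * b⁻¹}

/-- The group
`P_{i,1,k} = ⟨a, b, c | a^(p^i) = b^p = c^(p^k) = 1, [a,b] = [b,c] = 1, [a,c] = b⟩`. -/
abbrev GroupP (p i k : ℕ) : Type := PresentedGroup (relatorsP p i k)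

/-- The elementary abelian `2`-group `(ℤ₂)^n`, written multiplicatively. -/
abbrev ElemAbelianTwo (n : ℕ) : Type := Fin n → Multiplicative (ZMod 2)

/-! Element breadth one makes the derived subgroup central of order `p`, generated by some `z`, so
commutation is an alternating form on `G/Z(G)` over the field with `p` elements. If `[G : Z(G)] ≠
p^2`, every noncommuting pair has a noncentral element in its centralizer
(`exists_notMem_center_commute`), so there are commuting pairs independent modulo the center.

Subgroup breadth one enters through `mem_closure_pair_of_not_commute`: if `z ∉ ⟨x, y⟩`, the
normalizer of `⟨x, y⟩` centralizes it, and for `x`, `y` independent modulo the center its index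
exceeds `p`. Hence, for such a commuting pair, `z` is a product of powers of `x^p` and `y^p`.

Test this with a character `χ` of the center. Modulo `p`-th powers in the cyclic group `χ(Z(G))`,
the map `x ↦ χ(x^p)` is a homomorphism, at once for odd `p`, and for `p = 2` if `χ(z)` is a square
there. One then finds a commuting independent pair, corrected by central factors, with `χ(x^p) =
χ(y^p) = 1`, whence `χ(z) = 1` (`character_apply_eq_one`). Characters separate points, so `p = 2`;
the same test forces `Z(G)` to have exponent two (`center_sq_eq_one`).

Now each commuting independent pair satisfies `z ∈ {x^2, y^2, (xy)^2}`. This yields a noncentral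
involution `u`. For `v` not commuting with `u`, all noncentral elements of `C(u, v)` square to `z`,
so this centralizer is a quaternion group times central elements (`exists_generators`). The value of
`v^2` decides between `D_8` and `P_{2,1,1}`, and a complement in the center supplies the elementary
abelian factor. Conversely, both families have center of index at least eight. -/

open Subgroup in
/-- In a subgroup of prime order every element is a power of any nontrivial one. -/
theorem exists_eq_pow_of_card_prime {p : ℕ} [Fact p.Prime] {G : Type*} [Group G] {H : Subgroup G}
    (hH : Nat.card H = p) {c d : G} (hc : c ∈ H) (hc1 : c ≠ 1) (hd : d ∈ H) :
    ∃ k : ℕ, d = c ^ k := by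
  have := mem_powers_of_prime_card hH (g := ⟨c, hc⟩) (g' := ⟨d, hd⟩)
    (fun h => hc1 (congrArg Subtype.val h))
  obtain ⟨k, hk⟩ := this
  exact ⟨k, (congrArg Subtype.val hk).symm⟩

/-- A group is not the union of two proper subgroups. -/
theorem exists_notMem_and_notMem {G : Type*} [Group G] {H K : Subgroup G} {a b : G} (ha : a ∉ H)
    (hb : b ∉ K) : ∃ w, w ∉ H ∧ w ∉ K := by
  by_contra! h
  have haK := h a ha
  have hbH : b ∈ H := by
    by_contra hbH
    exact hb (h b hbH)
  by_cases hab : a * b ∈ H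
  · exact ha ((H.mul_mem_cancel_right hbH).1 hab)
  · exact hb ((K.mul_mem_cancel_left haK).1 (h _ hab))

/-! ### Element breadth one: the derived subgroup is central of order `p` -/

/-- The element `z` is central of order `p`, and all commutators lie in the subgroup it
generates. -/
structure CommutatorsMemZPowers {G : Type*} [Group G] (p : ℕ) (z : G) : Prop where
  mem_center : z ∈ Subgroup.center G
  orderOf_eq : orderOf z = p
  swap : ∀ x y : G, ∃ c ∈ Subgroup.zpowers z, y * x = c * (x * y)

/-- The homomorphism `g ↦ ⁅x, g⁆` of a group of class at most two. -/
def commutatorHom {G : Type*} [Group G] (h : ∀ x y : G, ⁅x, y⁆ ∈ Subgroup.center G) (x : G) :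
    G →* G :=
  MonoidHom.mk' (fun g => ⁅x, g⁆) fun a b => by
    have := Subgroup.mem_center_iff.1 (h x b) a
    simp only [commutatorElement_def] at this ⊢
    calc x * (a * b) * x⁻¹ * (a * b)⁻¹
        = x * a * x⁻¹ * a⁻¹ * (a * (x * b * x⁻¹ * b⁻¹)) * a⁻¹ := by group
      _ = x * a * x⁻¹ * a⁻¹ * (x * b * x⁻¹ * b⁻¹) := by rw [this]; group

theorem ker_commutatorHom {G : Type*} [Group G] (h : ∀ x y : G, ⁅x, y⁆ ∈ Subgroup.center G)
    (x : G) : (commutatorHom h x).ker = Subgroup.centralizer {x} := by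
  ext g
  rw [MonoidHom.mem_ker, Subgroup.mem_centralizer_singleton_iff]
  exact commutatorElement_eq_one_iff_mul_comm.trans eq_comm

theorem exists_not_commute {p : ℕ} {G : Type*} [Group G] [Finite G]
    (hebr : ebr p G = 1) : ∃ x y : G, ¬Commute x y := by
  by_contra! h
  obtain ⟨x, hx⟩ := (isGreatest_ebr p G).1
  have : Subgroup.centralizer {x} = ⊤ :=
    eq_top_iff.2 fun g _ => Subgroup.mem_centralizer_singleton_iff.2 (h g x)
  simp [ebrElem, this, hebr] at hx

section Breadth

variable {p : ℕ} [hp : Fact p.Prime] {G : Type*} [Group G] [Finite G]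

theorem index_centralizer_dvd (hG : IsPGroup p G) (hebr : ebr p G = 1) (x : G) :
    (Subgroup.centralizer {x}).index ∣ p := by
  have h : ebrElem p x ≤ 1 := hebr ▸ (isGreatest_ebr p G).2 ⟨x, rfl⟩
  rw [index_centralizer_eq_pow_ebrElem hG]
  simpa using pow_dvd_pow p h

theorem index_normalizer_dvd (hG : IsPGroup p G) (hsbr : sbr p G = 1) (H : Subgroup G) :
    (Subgroup.normalizer (H : Set G)).index ∣ p := by
  have h : sbrSubgroup p H ≤ 1 := hsbr ▸ (isGreatest_sbr p G).2 ⟨H, rfl⟩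
  rw [index_normalizer_eq_pow_sbrSubgroup hG]
  simpa using pow_dvd_pow p h

theorem index_centralizer_eq (hG : IsPGroup p G) (hebr : ebr p G = 1) {x : G}
    (hx : x ∉ Subgroup.center G) : (Subgroup.centralizer {x}).index = p := by
  refine ((Nat.dvd_prime hp.out).1 (index_centralizer_dvd hG hebr x)).resolve_left fun h => hx ?_
  rw [Subgroup.index_eq_one] at h
  exact Subgroup.mem_center_iff.2 fun g =>
    Subgroup.mem_centralizer_singleton_iff.1 (h ▸ Subgroup.mem_top g)

/-- The centralizer of a noncentral element has index `p`, hence is normal with cyclic quotient and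
contains the derived subgroup. -/
theorem commutatorElement_mem_center (hG : IsPGroup p G) (hebr : ebr p G = 1) (x y : G) :
    ⁅x, y⁆ ∈ Subgroup.center G := by
  refine Subgroup.mem_center_iff.2 fun g => ?_
  suffices ⁅x, y⁆ ∈ Subgroup.centralizer {g} from
    (Subgroup.mem_centralizer_singleton_iff.1 this).symm
  by_cases hg : g ∈ Subgroup.center G
  · exact Subgroup.mem_centralizer_singleton_iff.2 (Subgroup.mem_center_iff.1 hg _)
  have hi := index_centralizer_eq hG hebr hg
  have hn : (Subgroup.centralizer {g}).Normal := by
    apply Subgroup.normal_of_index_eq_minFac_card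
    obtain ⟨n, hn⟩ := IsPGroup.iff_card.1 hG
    rw [hi, hn, Nat.Prime.pow_minFac hp.out]
    rintro rfl
    have := (Subgroup.centralizer {g}).index_dvd_card
    rw [hi, hn, pow_zero, Nat.dvd_one] at this
    exact hp.out.one_lt.ne' this
  have hcyc : IsCyclic (G ⧸ Subgroup.centralizer {g}) := isCyclic_of_prime_card (p := p) hi
  have := hcyc.isMulCommutative
  have hle : commutator G ≤ Subgroup.centralizer {g} :=
    Subgroup.Normal.quotient_commutative_iff_commutator_le.1 inferInstance
  exact hle (Subgroup.commutator_mem_commutator (Subgroup.mem_top _) (Subgroup.mem_top _))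

/-- A finite `p`-group of element breadth one has derived subgroup central of order `p`. -/
theorem exists_commutatorsMemZPowers (hG : IsPGroup p G) (hebr : ebr p G = 1) :
    ∃ z : G, CommutatorsMemZPowers p z := by
  have hc := commutatorElement_mem_center hG hebr
  have hcard {x y : G} (h : ⁅x, y⁆ ≠ 1) : Nat.card (commutatorHom hc x).range = p := by
    rw [← Subgroup.index_ker, ker_commutatorHom]
    refine index_centralizer_eq hG hebr fun hx => h ?_
    exact commutatorElement_eq_one_iff_mul_comm.2 (Subgroup.mem_center_iff.1 hx y).symm
  have key {x y : G} (w : G) (h : ⁅x, y⁆ ≠ 1) : ⁅x, w⁆ ∈ Subgroup.zpowers ⁅x, y⁆ := by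
    obtain ⟨k, hk⟩ := exists_eq_pow_of_card_prime (hcard h) (c := ⁅x, y⁆) (d := ⁅x, w⁆)
      ⟨y, rfl⟩ h ⟨w, rfl⟩
    exact hk ▸ Subgroup.npow_mem_zpowers _ _
  have key' {x y : G} (w : G) (h : ⁅x, y⁆ ≠ 1) : ⁅w, y⁆ ∈ Subgroup.zpowers ⁅x, y⁆ := by
    rw [← commutatorElement_inv y w, ← commutatorElement_inv y x, Subgroup.zpowers_inv]
    refine inv_mem (key w fun h' => h ?_)
    rw [← commutatorElement_inv, h', inv_one]
  have hne {x y : G} : ⁅x, y⁆ = 1 ↔ y ∈ Subgroup.centralizer {x} := by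
    rw [Subgroup.mem_centralizer_singleton_iff, eq_comm (a := y * x)]
    exact commutatorElement_eq_one_iff_mul_comm
  obtain ⟨a, b, hab⟩ := exists_not_commute hebr
  replace hab : ⁅a, b⁆ ≠ 1 := fun h => hab (commutatorElement_eq_one_iff_mul_comm.1 h)
  refine ⟨⁅a, b⁆, hc a b, ?_, fun x y => ⟨⁅y, x⁆, ?_, by simp [commutatorElement_def]⟩⟩
  · have h1 : Subgroup.zpowers ⁅a, b⁆ = (commutatorHom hc a).range := by
      apply le_antisymm
      · exact Subgroup.zpowers_le.2 ⟨b, rfl⟩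
      · rintro _ ⟨w, rfl⟩
        exact key w hab
    rw [← Nat.card_zpowers, h1, hcard hab]
  · by_cases hxy : ⁅y, x⁆ = 1
    · exact hxy ▸ one_mem _
    -- A `w` outside the centralizers of both `a` and `y` links the two commutators: `⁅y, x⁆ ∈ ⟨⁅y,
    -- w⁆⟩ ≤ ⟨⁅a, w⁆⟩ ≤ ⟨⁅a, b⁆⟩`.
    obtain ⟨w, hw1, hw2⟩ := exists_notMem_and_notMem (fun h => hab (hne.2 h))
      (fun h => hxy (hne.2 h))
    rw [← hne] at hw1 hw2
    have e1 := key x hw2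
    have e2 := key' y hw1
    have e3 := key w hab
    exact Subgroup.zpowers_le.2 (Subgroup.zpowers_le.2 e3 e2) e1

end Breadth

/-! ### Class-two calculus and orthogonality for the commutator form -/

theorem pow_mul_of_mul_eq {G : Type*} [Group G] {x y c : G} (hc : c ∈ Subgroup.center G)
    (h : y * x = c * (x * y)) (n : ℕ) : y ^ n * x = c ^ n * (x * y ^ n) := by
  have hc' : ∀ g, g * c = c * g := Subgroup.mem_center_iff.1 hc
  induction n with
  | zero => simp
  | succ n ih =>
    calc y ^ (n + 1) * x = y ^ n * (y * x) := by rw [pow_succ, mul_assoc]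
      _ = y ^ n * c * x * y := by rw [h]; group
      _ = c * (y ^ n * x) * y := by rw [hc']; group
      _ = c ^ (n + 1) * (x * y ^ (n + 1)) := by rw [ih, pow_succ', pow_succ]; group

/-- Collecting the `x`'s to the left moves a `y` past an `x` exactly `n.choose 2` times. For `n = p`
this exponent is a multiple of `p` when `p` is odd, and is `1` when `p = 2`; hence the special role
of `2`. -/
theorem mul_pow_of_mul_eq {G : Type*} [Group G] {x y c : G} (hc : c ∈ Subgroup.center G)
    (h : y * x = c * (x * y)) (n : ℕ) : (x * y) ^ n = c ^ n.choose 2 * (x ^ n * y ^ n) := by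
  have hc' : ∀ g, ∀ k : ℕ, g * c ^ k = c ^ k * g := fun g k =>
    Subgroup.mem_center_iff.1 (pow_mem hc k) g
  induction n with
  | zero => simp
  | succ n ih =>
    calc (x * y) ^ (n + 1) = c ^ n.choose 2 * x ^ n * (y ^ n * x) * y := by
          rw [pow_succ, ih]; group
      _ = c ^ n.choose 2 * (x ^ n * c ^ n) * x * y ^ n * y := by
          rw [pow_mul_of_mul_eq hc h]; group
      _ = c ^ (n + 1).choose 2 * (x ^ (n + 1) * y ^ (n + 1)) := by
          rw [hc', Nat.choose_succ_succ', Nat.choose_one_right, add_comm, pow_add, pow_succ x,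
            pow_succ y]
          simp only [mul_assoc]

theorem commute_of_mem_closure_pair {G : Type*} [Group G] {s t m x : G}
    (hm : m ∈ Subgroup.closure {s, t}) (hs : Commute x s) (ht : Commute x t) : Commute x m := by
  have : Subgroup.closure {s, t} ≤ Subgroup.centralizer {x} := by
    rw [Subgroup.closure_le]
    rintro _ (rfl | rfl)
    · exact Subgroup.mem_centralizer_singleton_iff.2 hs.eq.symm
    · exact Subgroup.mem_centralizer_singleton_iff.2 ht.eq.symm
  exact (Subgroup.mem_centralizer_singleton_iff.1 (this hm)).symm

theorem notMem_center_of_not_commute {G : Type*} [Group G] {x y : G} (h : ¬Commute x y) :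
    x ∉ Subgroup.center G := fun hx => h (Subgroup.mem_center_iff.1 hx y).symm

theorem exists_not_commute_of_notMem_center {G : Type*} [Group G] {x : G}
    (h : x ∉ Subgroup.center G) : ∃ y, ¬Commute x y := by
  by_contra! h'
  exact h (Subgroup.mem_center_iff.2 fun g => (h' g).symm)

namespace CommutatorsMemZPowers

variable {p : ℕ} [hp : Fact p.Prime] {G : Type*} [Group G] {z : G}

theorem ne_one (D : CommutatorsMemZPowers p z) : z ≠ 1 := by
  rintro rfl
  exact hp.out.one_lt.ne (orderOf_one.symm.trans D.orderOf_eq)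

omit hp in
theorem zpowers_le_center (D : CommutatorsMemZPowers p z) :
    Subgroup.zpowers z ≤ Subgroup.center G :=
  Subgroup.zpowers_le.2 D.mem_center

omit hp in
theorem pow_eq_one (D : CommutatorsMemZPowers p z) {c : G} (hc : c ∈ Subgroup.zpowers z) :
    c ^ p = 1 := by
  obtain ⟨k, rfl⟩ := hc
  dsimp only
  rw [← zpow_natCast, zpow_comm, zpow_natCast, ← D.orderOf_eq, pow_orderOf_eq_one, one_zpow]

omit hp in
theorem pow_mem_center (D : CommutatorsMemZPowers p z) (x : G) : x ^ p ∈ Subgroup.center G := by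
  refine Subgroup.mem_center_iff.2 fun y => ?_
  obtain ⟨c, hc, h⟩ := D.swap y x
  rw [pow_mul_of_mul_eq (D.zpowers_le_center hc) h, D.pow_eq_one hc, one_mul]

theorem exists_eq_pow (D : CommutatorsMemZPowers p z) {c d : G} (hc : c ∈ Subgroup.zpowers z)
    (hc1 : c ≠ 1) (hd : d ∈ Subgroup.zpowers z) : ∃ k : ℕ, d = c ^ k :=
  exists_eq_pow_of_card_prime (p := p) ((Nat.card_zpowers z).trans D.orderOf_eq) hc hc1 hd

/-- The commutator of `s` and `t` generates the group of order `p` containing all commutators, so a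
power of `t` cancels the commutator of `s` and `g`. -/
theorem exists_commute_mul_pow (D : CommutatorsMemZPowers p z) {s t : G} (h : ¬Commute s t)
    (g : G) : ∃ k : ℕ, Commute (g * t ^ k) s := by
  obtain ⟨c, hc, hst⟩ := D.swap s t
  obtain ⟨d, hd, hsg⟩ := D.swap s g
  obtain ⟨k, hk⟩ := D.exists_eq_pow hc (by rintro rfl; exact h (hst.trans (one_mul _)).symm)
    (inv_mem hd)
  refine ⟨k, ?_⟩
  have hcc := D.zpowers_le_center hc
  have hck := Subgroup.mem_center_iff.1 (pow_mem hcc k)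
  calc g * t ^ k * s = g * (t ^ k * s) := mul_assoc ..
    _ = (g * c ^ k) * s * t ^ k := by rw [pow_mul_of_mul_eq hcc hst]; group
    _ = s * (g * t ^ k) := by
      rw [hck, ← hk, mul_assoc d⁻¹, hsg]; group

/-- Gram–Schmidt for the commutator form: the hyperbolic plane spanned by `s` and `t` splits off. -/
theorem exists_mul_commute (D : CommutatorsMemZPowers p z) {s t : G} (h : ¬Commute s t) (g : G) :
    ∃ m ∈ Subgroup.closure {s, t}, Commute (g * m) s ∧ Commute (g * m) t := by
  obtain ⟨j, hj⟩ := D.exists_commute_mul_pow h g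
  obtain ⟨i, hi⟩ := D.exists_commute_mul_pow (fun h' => h h'.symm) (g * t ^ j)
  refine ⟨t ^ j * s ^ i, mul_mem ?_ ?_, ?_, ?_⟩
  · exact pow_mem (Subgroup.subset_closure (by simp)) _
  · exact pow_mem (Subgroup.subset_closure (by simp)) _
  · rw [← mul_assoc]
    exact hj.mul_left (Commute.pow_self s i)
  · rwa [← mul_assoc]

/-- Inside the centralizer of a noncommuting pair, an element that is not central has a partner
that does not commute with it. -/
theorem exists_not_commute_of_commute (D : CommutatorsMemZPowers p z) {s t x : G}
    (h : ¬Commute s t) (hx : x ∉ Subgroup.center G) (hs : Commute x s) (ht : Commute x t) :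
    ∃ y, ¬Commute x y ∧ Commute y s ∧ Commute y t := by
  obtain ⟨y, hy⟩ := exists_not_commute_of_notMem_center hx
  obtain ⟨m, hm, h1, h2⟩ := D.exists_mul_commute h y
  refine ⟨y * m, fun h' => hy ?_, h1, h2⟩
  have := h'.mul_right (commute_of_mem_closure_pair hm hs ht).inv_right
  rwa [mul_inv_cancel_right] at this

end CommutatorsMemZPowers

/-! ### Subgroup breadth one, and centers of index other than `p^2` -/

section Breadth

variable {p : ℕ} [hp : Fact p.Prime] {G : Type*} [Group G] [Finite G]

-- A commutator of `H = ⟨x, y⟩` with its normalizer lies in `H ∩ ⟨z⟩`, which is trivial if `z ∉ H`.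
-- The normalizer then lies in `C(x) ∩ C(y)`, a proper subgroup of `C(x)` because of `g`, so its
-- index exceeds `p`.
open CommutatorsMemZPowers in
theorem mem_closure_pair_of_not_commute (hG : IsPGroup p G) (hebr : ebr p G = 1)
    (hsbr : sbr p G = 1) {z : G} (D : CommutatorsMemZPowers p z) {x y g : G} (hxg : Commute x g)
    (hyg : ¬Commute y g) (hx : x ∉ Subgroup.center G) : z ∈ Subgroup.closure {x, y} := by
  by_contra hz
  set H := Subgroup.closure {x, y} with hH
  have hxH : x ∈ H := Subgroup.subset_closure (by simp)
  have hyH : y ∈ H := Subgroup.subset_closure (by simp)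
  have hle : Subgroup.normalizer (H : Set G) ≤
      Subgroup.centralizer {x} ⊓ Subgroup.centralizer {y} := by
    have key : ∀ n ∈ Subgroup.normalizer (H : Set G), ∀ h ∈ H, n * h = h * n := by
      intro n hn h hh
      obtain ⟨c, hc, hs⟩ := D.swap h n
      suffices c = 1 by rw [hs, this, one_mul]
      by_contra hc1
      obtain ⟨k, hk⟩ := D.exists_eq_pow hc hc1 (Subgroup.mem_zpowers z)
      apply hz
      rw [hk]
      refine pow_mem ?_ k
      have : c = n * h * n⁻¹ * h⁻¹ := by rw [hs]; group
      rw [this]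
      exact mul_mem ((Subgroup.mem_normalizer_iff.1 hn h).1 hh) (inv_mem hh)
    intro n hn
    exact ⟨Subgroup.mem_centralizer_singleton_iff.2 (key n hn x hxH),
      Subgroup.mem_centralizer_singleton_iff.2 (key n hn y hyH)⟩
  have h1 := (Subgroup.index_dvd_of_le hle).trans (index_normalizer_dvd hG hsbr H)
  have h2 : (Subgroup.centralizer {x}).index = p := index_centralizer_eq hG hebr hx
  have h3 := Nat.le_of_dvd hp.out.pos h1
  have h4 : Subgroup.centralizer {x} ⊓ Subgroup.centralizer {y} < Subgroup.centralizer {x} := by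
    refine lt_of_le_of_ne inf_le_left fun h => hyg ?_
    have : g ∈ Subgroup.centralizer {x} := Subgroup.mem_centralizer_singleton_iff.2 hxg.eq.symm
    rw [← h] at this
    exact (Subgroup.mem_centralizer_singleton_iff.1 this.2).symm
  have := Subgroup.index_strictAnti h4
  omega

/-- Otherwise `C(s) ∩ C(t)` is the center. Its index is then at most `p^2`, and more than `p` since
`C(s)` contains the noncentral `s`. -/
theorem exists_notMem_center_commute (hG : IsPGroup p G) (hebr : ebr p G = 1)
    (hZ : (Subgroup.center G).index ≠ p ^ 2) {s t : G}
    (hst : ¬Commute s t) : ∃ x ∉ Subgroup.center G, Commute x s ∧ Commute x t := by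
  by_contra! h
  apply hZ
  have hs := index_centralizer_eq hG hebr (notMem_center_of_not_commute hst)
  have ht := index_centralizer_eq hG hebr (notMem_center_of_not_commute fun h' => hst h'.symm)
  have hle : Subgroup.centralizer {s} ⊓ Subgroup.centralizer {t} = Subgroup.center G := by
    apply le_antisymm
    · rintro x ⟨hxs, hxt⟩
      by_contra hx
      exact h x hx (Subgroup.mem_centralizer_singleton_iff.1 hxs)
        (Subgroup.mem_centralizer_singleton_iff.1 hxt)
    · exact le_inf (Subgroup.center_le_centralizer _) (Subgroup.center_le_centralizer _)
  have h1 : (Subgroup.center G).index ≤ p * p := by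
    have := Subgroup.index_inf_le (H := Subgroup.centralizer {s}) (K := Subgroup.centralizer {t})
    rwa [hle, hs, ht] at this
  have h2 : p < (Subgroup.center G).index := by
    rw [← hs]
    apply Subgroup.index_strictAnti
    refine lt_of_le_of_ne (Subgroup.center_le_centralizer _) fun h' => ?_
    have : s ∈ Subgroup.center G := by
      rw [h']
      exact Subgroup.mem_centralizer_singleton_iff.2 rfl
    exact notMem_center_of_not_commute hst this
  obtain ⟨n, hn⟩ := hG.index (Subgroup.center G)
  rw [hn] at h1 h2 ⊢
  have h3 := (Nat.pow_le_pow_iff_right (m := 2) hp.out.one_lt).1 (h1.trans_eq (sq p).symm)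
  have h4 := (Nat.pow_lt_pow_iff_right (n := 1) hp.out.one_lt).1 ((pow_one p).trans_lt h2)
  rw [le_antisymm h3 h4]

end Breadth

/-! ### The `p`-th power map tested by characters of the center -/

theorem exists_eq_zpow_mul_zpow {G : Type*} [Group G] {x y h : G} (hxy : Commute x y)
    (hh : h ∈ Subgroup.closure {x, y}) : ∃ i j : ℤ, h = x ^ i * y ^ j := by
  induction hh using Subgroup.closure_induction with
  | mem a ha =>
    rcases ha with rfl | rfl
    · exact ⟨1, 0, by simp⟩
    · exact ⟨0, 1, by simp⟩
  | one => exact ⟨0, 0, by simp⟩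
  | mul a b _ _ iha ihb =>
    obtain ⟨i, j, rfl⟩ := iha
    obtain ⟨k, l, rfl⟩ := ihb
    refine ⟨i + k, j + l, ?_⟩
    rw [zpow_add, zpow_add, mul_assoc, ← mul_assoc (y ^ j), ← (hxy.zpow_zpow k j).eq]
    group
  | inv a _ iha =>
    obtain ⟨i, j, rfl⟩ := iha
    refine ⟨-i, -j, ?_⟩
    rw [mul_inv_rev, zpow_neg, zpow_neg]
    exact ((hxy.zpow_zpow i j).inv_inv).eq.symm

theorem dvd_of_zpow_mem {G : Type*} [Group G] {p : ℕ} (hp : p.Prime) {H : Subgroup G} {x : G}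
    {i : ℤ} (hx : x ∉ H) (hxp : x ^ p ∈ H) (hi : x ^ i ∈ H) : (p : ℤ) ∣ i := by
  by_contra h
  have h1 : IsCoprime (p : ℤ) i := (Prime.coprime_iff_not_dvd (Nat.prime_iff_prime_int.1 hp)).2 h
  obtain ⟨a, b, hab⟩ := h1
  apply hx
  rw [← zpow_one x, ← hab, zpow_add, mul_comm a, mul_comm b, zpow_mul, zpow_mul, zpow_natCast]
  exact mul_mem (zpow_mem hxp a) (zpow_mem hi b)

theorem mem_centralizer_singleton_iff_commute {G : Type*} [Group G] {x g : G} :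
    x ∈ Subgroup.centralizer {g} ↔ Commute x g :=
  Subgroup.mem_centralizer_singleton_iff

namespace CommutatorsMemZPowers

variable {p : ℕ} [hp : Fact p.Prime] {G : Type*} [Group G] {z : G}

/-- The central elements of `⟨x, y⟩`, for commuting `x` and `y` that are independent modulo the
center, are generated by `x ^ p` and `y ^ p`. -/
theorem exists_eq_pow_zpow_mul_pow_zpow (D : CommutatorsMemZPowers p z) {x y g h : G}
    (hxy : Commute x y) (hxg : Commute x g) (hyg : ¬Commute y g) (hx : x ∉ Subgroup.center G)
    (hh : h ∈ Subgroup.closure {x, y}) (hc : h ∈ Subgroup.center G) :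
    ∃ i j : ℤ, h = (x ^ p) ^ i * (y ^ p) ^ j := by
  obtain ⟨i, j, rfl⟩ := exists_eq_zpow_mul_zpow hxy hh
  -- Commuting with `g` detects `j` modulo `p`, because `x` commutes with `g` and `y` does not.
  have hj : (p : ℤ) ∣ j := by
    refine dvd_of_zpow_mem hp.out (H := Subgroup.centralizer {g})
      (mt mem_centralizer_singleton_iff_commute.1 hyg)
      (Subgroup.center_le_centralizer _ (D.pow_mem_center y)) ?_
    have := Subgroup.center_le_centralizer {g} hc
    rwa [Subgroup.mul_mem_cancel_left _
      (mem_centralizer_singleton_iff_commute.2 (hxg.zpow_left i))] at this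
  obtain ⟨j, rfl⟩ := hj
  rw [zpow_mul y, zpow_natCast] at hc
  rw [Subgroup.mul_mem_cancel_right _ (zpow_mem (D.pow_mem_center y) j)] at hc
  obtain ⟨i, rfl⟩ := dvd_of_zpow_mem hp.out hx (D.pow_mem_center x) hc
  exact ⟨i, j, by simp only [zpow_mul, zpow_natCast]⟩

/-- The `p`-th power map into the center. -/
def powCenter (D : CommutatorsMemZPowers p z) (x : G) : Subgroup.center G :=
  ⟨x ^ p, D.pow_mem_center x⟩

/-- Modulo `p`-th powers of the image of `χ`, the map `x ↦ χ (x ^ p)` is multiplicative: the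
commutator term dies for odd `p` and is a square by `hχ` for `p = 2`. The image is cyclic, so this
quotient has order at most `p`, and either `a` or some `b * a ^ i` is sent to the trivial class. -/
theorem exists_powCenter_eq_pow (D : CommutatorsMemZPowers p z) {χ : Subgroup.center G →* ℂˣ}
    [Finite G] (hχ : p = 2 → ∃ d, χ ⟨z, D.mem_center⟩ = χ d ^ 2) (a b : G) :
    (∃ c, χ (D.powCenter a) = χ c ^ p) ∨ ∃ i : ℕ, ∃ c, χ (D.powCenter (b * a ^ i)) = χ c ^ p := by
  have hmul (a b : G) :
      ∃ d, χ (D.powCenter (a * b)) = χ (D.powCenter a) * χ (D.powCenter b) * χ d ^ p := by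
    obtain ⟨c, hc, h⟩ := D.swap a b
    have hpow := mul_pow_of_mul_eq (D.zpowers_le_center hc) h p
    have he : D.powCenter (a * b) =
        ⟨c, D.zpowers_le_center hc⟩ ^ p.choose 2 * (D.powCenter a * D.powCenter b) :=
      Subtype.ext hpow
    rw [he, map_mul, map_mul, map_pow]
    rcases hp.out.eq_two_or_odd' with rfl | hodd
    · obtain ⟨d, hd⟩ := hχ rfl
      obtain ⟨k, rfl⟩ := hc
      refine ⟨d ^ k, ?_⟩
      have : (⟨z ^ k, D.zpowers_le_center ⟨k, rfl⟩⟩ : Subgroup.center G) =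
        ⟨z, D.mem_center⟩ ^ k := rfl
      rw [Nat.choose_self, pow_one, mul_comm, this, map_zpow, hd, map_zpow, ← zpow_natCast,
        ← zpow_natCast, zpow_comm]
    · refine ⟨1, ?_⟩
      obtain ⟨m, hm⟩ : p ∣ p.choose 2 := by
        refine hp.out.dvd_choose_self (by norm_num) ?_
        exact lt_of_le_of_ne hp.out.two_le fun h => absurd (h ▸ hodd) (by decide)
      have h1 : (⟨c, D.zpowers_le_center hc⟩ : Subgroup.center G) ^ p = 1 :=
        Subtype.ext (D.pow_eq_one hc)
      rw [hm, pow_mul, ← map_pow, h1]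
      simp
  have : Finite χ.range := Set.finite_range χ |>.to_subtype
  obtain ⟨⟨_, c₀, rfl⟩, hgen⟩ := IsCyclic.exists_generator (α := χ.range)
  have hgen' (c : Subgroup.center G) : ∃ k : ℤ, χ c = χ c₀ ^ k := by
    obtain ⟨k, hk⟩ := hgen ⟨χ c, c, rfl⟩
    exact ⟨k, (congrArg Subtype.val hk).symm⟩
  obtain ⟨m, hm⟩ := hgen' (D.powCenter a)
  obtain ⟨n, hn⟩ := hgen' (D.powCenter b)
  by_cases hpm : (p : ℤ) ∣ m
  · obtain ⟨q, rfl⟩ := hpm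
    left
    refine ⟨c₀ ^ q, ?_⟩
    rw [hm, map_zpow, ← zpow_natCast, ← zpow_mul, mul_comm]
  · right
    have hm0 : (m : ZMod p) ≠ 0 := fun h => hpm ((ZMod.intCast_zmod_eq_zero_iff_dvd m p).1 h)
    -- `i` solves `n + m * i ≡ 0` modulo `p`, which makes the exponent of the generator divisible by
    -- `p`.
    obtain ⟨i, hi⟩ := ZMod.natCast_zmod_surjective (-(n : ZMod p) / (m : ZMod p))
    have hdvd : (p : ℤ) ∣ n + m * i := by
      rw [← ZMod.intCast_zmod_eq_zero_iff_dvd]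
      push_cast
      rw [hi, mul_div_cancel₀ _ hm0, add_neg_cancel]
    obtain ⟨q, hq⟩ := hdvd
    obtain ⟨d, hd⟩ := hmul b (a ^ i)
    have hpa : D.powCenter (a ^ i) = D.powCenter a ^ i := Subtype.ext (pow_right_comm a i p)
    refine ⟨i, c₀ ^ q * d, ?_⟩
    rw [hd, hpa, map_pow, hm, hn, ← zpow_natCast (χ c₀ ^ m), ← zpow_mul, ← zpow_add, hq, map_mul,
      map_zpow, mul_pow, ← zpow_natCast (χ c₀ ^ q), ← zpow_mul, mul_comm q]

omit hp in
theorem exists_powCenter_eq_one (D : CommutatorsMemZPowers p z) {χ : Subgroup.center G →* ℂˣ}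
    {x : G} (h : ∃ c, χ (D.powCenter x) = χ c ^ p) :
    ∃ c ∈ Subgroup.center G, χ (D.powCenter (x * c)) = 1 := by
  obtain ⟨c, hc⟩ := h
  refine ⟨c⁻¹, inv_mem c.2, ?_⟩
  have : D.powCenter (x * (c : G)⁻¹) = D.powCenter x * c⁻¹ ^ p := by
    apply Subtype.ext
    have : Commute x (c : G)⁻¹ := Subgroup.mem_center_iff.1 (inv_mem c.2) x
    exact this.mul_pow p
  rw [this, map_mul, hc, map_pow, map_inv, inv_pow, mul_inv_cancel]

end CommutatorsMemZPowers

section Breadth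

variable {p : ℕ} [hp : Fact p.Prime] {G : Type*} [Group G] [Finite G] {z : G}

/-- The central element `z` is detected by no character of the center that is compatible with
`p`-th powers. -/
theorem character_apply_eq_one (hG : IsPGroup p G) (hebr : ebr p G = 1) (hsbr : sbr p G = 1)
    (hZ : (Subgroup.center G).index ≠ p ^ 2) (D : CommutatorsMemZPowers p z)
    {χ : Subgroup.center G →* ℂˣ} (hχ : p = 2 → ∃ d, χ ⟨z, D.mem_center⟩ = χ d ^ 2) :
    χ ⟨z, D.mem_center⟩ = 1 := by
  have hor := D.exists_powCenter_eq_pow hχ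
  have hne {a b : G} (i : ℕ) (h : ¬Commute b a) : ¬Commute (b * a ^ i) a := fun h' => h (by
    have := h'.mul_left (Commute.pow_self a i).inv_left
    rwa [mul_inv_cancel_right] at this)
  obtain ⟨x, hx, hxN⟩ : ∃ x ∉ Subgroup.center G, ∃ c, χ (D.powCenter x) = χ c ^ p := by
    obtain ⟨s, t, hst⟩ := exists_not_commute hebr
    rcases hor s t with h | ⟨i, h⟩
    · exact ⟨s, notMem_center_of_not_commute hst, h⟩
    · exact ⟨_, notMem_center_of_not_commute (hne i fun h => hst h.symm), h⟩
  -- Both `y` and its witness `g` come from a noncommuting pair inside the centralizer of `x`, so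
  -- `x` and `y` are independent modulo the center.
  obtain ⟨y, g, hxy, hxg, hyg, hyN⟩ : ∃ y g, Commute x y ∧ Commute x g ∧ ¬Commute y g ∧
      ∃ c, χ (D.powCenter y) = χ c ^ p := by
    obtain ⟨w, hw⟩ := exists_not_commute_of_notMem_center hx
    obtain ⟨a, ha, hax, haw⟩ := exists_notMem_center_commute hG hebr hZ hw
    obtain ⟨b, hab, hbx, -⟩ := D.exists_not_commute_of_commute hw ha hax haw
    rcases hor a b with h | ⟨i, h⟩
    · exact ⟨a, b, hax.symm, hbx.symm, hab, h⟩
    · exact ⟨_, a, (hbx.mul_left (hax.pow_left i)).symm, hax.symm, hne i fun h => hab h.symm, h⟩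
  -- Central factors change no commutation relation but make `χ` trivial on both `p`-th powers.
  obtain ⟨c, hc, hxc⟩ := D.exists_powCenter_eq_one hxN
  obtain ⟨d, hd, hyd⟩ := D.exists_powCenter_eq_one hyN
  have hcc (g : G) : Commute c g := (Subgroup.mem_center_iff.1 hc g).symm
  have hdc (g : G) : Commute d g := (Subgroup.mem_center_iff.1 hd g).symm
  have hxg' : Commute (x * c) g := hxg.mul_left (hcc g)
  have hyg' : ¬Commute (y * d) g := fun h => hyg (by
    have := h.mul_left (hdc g).inv_left
    rwa [mul_inv_cancel_right] at this)
  have hx' : x * c ∉ Subgroup.center G := by rwa [Subgroup.mul_mem_cancel_right _ hc]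
  have hxy' : Commute (x * c) (y * d) :=
    (hxy.mul_right (hdc x).symm).mul_left (hcc _)
  obtain ⟨i, j, hij⟩ := D.exists_eq_pow_zpow_mul_pow_zpow hxy' hxg' hyg' hx'
    (mem_closure_pair_of_not_commute hG hebr hsbr D hxg' hyg' hx') D.mem_center
  have : (⟨z, D.mem_center⟩ : Subgroup.center G) =
    D.powCenter (x * c) ^ i * D.powCenter (y * d) ^ j := Subtype.ext hij
  rw [this, map_mul, map_zpow, map_zpow, hxc, hyd, one_zpow, one_zpow, one_mul]

omit hp in
theorem exists_character_apply_ne_one {a : Subgroup.center G} (ha : a ≠ 1) :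
    ∃ χ : Subgroup.center G →* ℂˣ, χ a ≠ 1 :=
  letI : CommGroup (Subgroup.center G) :=
    { (inferInstance : Group (Subgroup.center G)) with mul_comm := mul_comm' }
  CommGroup.exists_apply_ne_one_of_hasEnoughRootsOfUnity (Subgroup.center G) ℂ ha

theorem eq_two_of_index_center_ne (hG : IsPGroup p G) (hebr : ebr p G = 1) (hsbr : sbr p G = 1)
    (hZ : (Subgroup.center G).index ≠ p ^ 2) (D : CommutatorsMemZPowers p z) : p = 2 := by
  by_contra hp2
  obtain ⟨χ, hχ⟩ := exists_character_apply_ne_one (a := (⟨z, D.mem_center⟩ : Subgroup.center G))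
    fun h => D.ne_one (congrArg Subtype.val h)
  exact hχ (character_apply_eq_one hG hebr hsbr hZ D fun h => absurd h hp2)

end Breadth

/-! ### For `p = 2` the center has exponent two -/

theorem units_eq_neg_one {a : ℂˣ} (h2 : a ^ 2 = 1) (h1 : a ≠ 1) : a = -1 := by
  have h : (a : ℂ) ^ 2 = 1 := by rw [← Units.val_pow_eq_pow_val, h2, Units.val_one]
  rcases sq_eq_one_iff.1 h with h | h
  · exact absurd (Units.ext h) h1
  · exact Units.ext h

theorem center_sq_eq_one {G : Type*} [Group G] [Finite G] {z : G} (hG : IsPGroup 2 G)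
    (hebr : ebr 2 G = 1) (hsbr : sbr 2 G = 1) (hZ : (Subgroup.center G).index ≠ 2 ^ 2)
    (D : CommutatorsMemZPowers 2 z) {t : G} (ht : t ∈ Subgroup.center G) : t ^ 2 = 1 := by
  by_contra ht2
  obtain ⟨t, htc, ht1, ht2⟩ : ∃ t ∈ Subgroup.center G, t ^ 2 ≠ 1 ∧ (t ^ 2) ^ 2 = 1 := by
    obtain ⟨k, hk⟩ := hG t
    induction k generalizing t with
    | zero =>
      rw [pow_zero, pow_one] at hk
      simp [hk] at ht2
    | succ k ih =>
      by_cases h : (t ^ 2) ^ 2 = 1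
      · exact ⟨t, ht, ht2, h⟩
      · exact ih (pow_mem ht 2) h (by rw [← pow_mul, ← pow_succ', hk])
  have main := fun χ => character_apply_eq_one hG hebr hsbr hZ D (χ := χ)
  set z' : Subgroup.center G := ⟨z, D.mem_center⟩
  set t' : Subgroup.center G := ⟨t, htc⟩
  have hz2 : z' ^ 2 = 1 := Subtype.ext (D.pow_eq_one (Subgroup.mem_zpowers z))
  have ht2' : (t' ^ 2) ^ 2 = 1 := Subtype.ext ht2
  have hval (χ : Subgroup.center G →* ℂˣ) {a : Subgroup.center G} (ha : a ^ 2 = 1)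
      (h : χ a ≠ 1) : χ a = -1 := units_eq_neg_one (by rw [← map_pow, ha, map_one]) h
  -- If both values were `-1`, then `χ z' = χ t' ^ 2` would be a square, which
  -- `character_apply_eq_one` excludes.
  have key (χ : Subgroup.center G →* ℂˣ) (h1 : χ z' ≠ 1) : χ (t' ^ 2) = 1 := by
    by_contra h2
    refine h1 (main χ fun _ => ⟨t', ?_⟩)
    rw [← map_pow, hval χ hz2 h1, hval χ ht2' h2]
  obtain ⟨χ, hχ⟩ := exists_character_apply_ne_one (a := z')
    fun h => D.ne_one (congrArg Subtype.val h)
  obtain ⟨ψ, hψ⟩ := exists_character_apply_ne_one (a := t' ^ 2)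
    fun h => ht1 (congrArg Subtype.val h)
  have hψz : ψ z' = 1 := by
    by_contra h
    exact hψ (key ψ h)
  -- `χ` detects `z` and `ψ` kills it, so `χ * ψ` detects `z` as well; then `key` for `χ` and `χ *
  -- ψ` gives `ψ (t' ^ 2) = 1`.
  have := key (χ * ψ) (by rwa [MonoidHom.mul_apply, hψz, mul_one])
  rw [MonoidHom.mul_apply, key χ hχ, one_mul] at this
  exact hψ this

/-! ### Squares and generators for `p = 2` -/

theorem zpow_eq_ite_of_sq_eq_one {G : Type*} [Group G] {a : G} (ha : a ^ 2 = 1) (k : ℤ) :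
    a ^ k = if Even k then 1 else a := by
  rcases k.even_or_odd' with ⟨k, rfl | rfl⟩
  · rw [zpow_mul, zpow_ofNat, ha, one_zpow, if_pos (even_two_mul k)]
  · rw [zpow_add, zpow_mul, zpow_ofNat, ha, one_zpow, one_mul, zpow_one,
      if_neg (Int.not_even_two_mul_add_one k)]

theorem zpow_eq_one_or_eq_of_sq_eq_one {G : Type*} [Group G] {a : G} (ha : a ^ 2 = 1) (k : ℤ) :
    a ^ k = 1 ∨ a ^ k = a := by
  rw [zpow_eq_ite_of_sq_eq_one ha]
  exact ite_eq_or_eq _ _ _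

theorem commute_mul_iff_of_commute_left {G : Type*} [Group G] {a b c : G} (h : Commute a c) :
    Commute (a * b) c ↔ Commute b c :=
  ⟨fun h' => by simpa using h.inv_left.mul_left h', h.mul_left⟩

theorem commute_mul_iff_of_commute_right {G : Type*} [Group G] {a b c : G} (h : Commute b c) :
    Commute (a * b) c ↔ Commute a c :=
  ⟨fun h' => by simpa using h'.mul_left h.inv_left, fun h' => h'.mul_left h⟩

namespace CommutatorsMemZPowers

variable {G : Type*} [Group G] {z : G}

theorem sq_eq_one (D : CommutatorsMemZPowers 2 z) : z ^ 2 = 1 :=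
  D.pow_eq_one (Subgroup.mem_zpowers z)

theorem mul_eq_of_not_commute (D : CommutatorsMemZPowers 2 z) {x y : G} (h : ¬Commute x y) :
    y * x = z * (x * y) := by
  obtain ⟨c, ⟨k, rfl⟩, hc⟩ := D.swap x y
  have hc' : y * x = z ^ k * (x * y) := hc
  rcases zpow_eq_one_or_eq_of_sq_eq_one D.sq_eq_one k with hk | hk
  · rw [hk, one_mul] at hc'
    exact absurd hc'.symm h
  · rwa [hk] at hc'

theorem mul_sq_of_not_commute (D : CommutatorsMemZPowers 2 z) {x y : G} (h : ¬Commute x y) :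
    (x * y) ^ 2 = z * (x ^ 2 * y ^ 2) := by
  rw [mul_pow_of_mul_eq D.mem_center (D.mul_eq_of_not_commute h), Nat.choose_self, pow_one]

theorem commute_of_mul_mem_center {s t g : G} (h : s * t ∈ Subgroup.center G)
    (hg : Commute t g) : Commute s g :=
  (commute_mul_iff_of_commute_right hg).1 (Subgroup.mem_center_iff.1 h g).symm

/-- If any two commuting elements that are independent modulo the center generate a subgroup
containing `z`, there is a noncentral involution. -/
theorem exists_sq_eq_one (D : CommutatorsMemZPowers 2 z) (hnc : ∃ x y : G, ¬Commute x y)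
    (hI : ∀ s t : G, ¬Commute s t → ∃ x ∉ Subgroup.center G, Commute x s ∧ Commute x t)
    (hT : ∀ x y g : G, x ∉ Subgroup.center G → Commute x y → Commute x g → ¬Commute y g →
      x ^ 2 = z ∨ y ^ 2 = z ∨ (x * y) ^ 2 = z) :
    ∃ u ∉ Subgroup.center G, u ^ 2 = 1 := by
  by_contra! hno
  have hz : z * z = 1 := by rw [← sq, D.sq_eq_one]
  have hpair (a b : G) (hab : ¬Commute a b) :
      ∃ x y, ¬Commute x y ∧ (Commute x a ∧ Commute x b) ∧ Commute y a ∧ Commute y b := by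
    obtain ⟨x, hx, hxa, hxb⟩ := hI a b hab
    obtain ⟨y, hxy, hya, hyb⟩ := D.exists_not_commute_of_commute hab hx hxa hxb
    exact ⟨x, y, hxy, ⟨hxa, hxb⟩, hya, hyb⟩
  obtain ⟨s, hs, hs2⟩ : ∃ s ∉ Subgroup.center G, s ^ 2 = z := by
    obtain ⟨a, b, hab⟩ := hnc
    obtain ⟨x, y, hxy, ⟨hxa, hxb⟩, hya, hyb⟩ := hpair a b hab
    have ha := notMem_center_of_not_commute hab
    rcases hT a x y ha hxa.symm hya.symm hxy with h | h | h
    · exact ⟨a, ha, h⟩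
    · exact ⟨x, notMem_center_of_not_commute hxy, h⟩
    · refine ⟨a * x, notMem_center_of_not_commute (y := b) fun h' => hab ?_, h⟩
      exact (commute_mul_iff_of_commute_right hxb).1 h'
  -- Otherwise `x` would be a noncentral involution or trivial, against `hno`.
  have hnot {s x : G} (hs2 : s ^ 2 = z) (hx : x ∉ Subgroup.center G) (h : Commute x s) :
      (x * s) ^ 2 ≠ z := by
    rw [h.mul_pow, hs2]
    exact fun h' => hno x hx (by simpa using h')
  obtain ⟨t, hst, ht2⟩ : ∃ t, ¬Commute s t ∧ t ^ 2 = z := by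
    obtain ⟨g, hg⟩ := exists_not_commute_of_notMem_center hs
    obtain ⟨h, k, hhk, ⟨hhg, -⟩, hkg, -⟩ := hpair g s fun h => hg h.symm
    have hcg : ∃ t, Commute t g ∧ t ^ 2 = z := by
      rcases hT g h k (notMem_center_of_not_commute fun h => hg h.symm) hhg.symm hkg.symm hhk with
        h' | h' | h'
      · exact ⟨g, .refl g, h'⟩
      · exact ⟨h, hhg, h'⟩
      · exact ⟨g * h, (Commute.refl g).mul_left hhg, h'⟩
    obtain ⟨t, htg, ht2⟩ := hcg
    -- If `s` and `t` commuted, `s * t` would square to `1` and be central; then `s` would commute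
    -- with `g`, since `t` does.
    refine ⟨t, fun hst => hno (s * t) (fun hc => hg (commute_of_mul_mem_center hc htg)) ?_, ht2⟩
    rw [hst.mul_pow, hs2, ht2, hz]
  obtain ⟨x, y, hxy, ⟨hxs, hxt⟩, hys, hyt⟩ := hpair s t hst
  have hxc := notMem_center_of_not_commute hxy
  have hyc := notMem_center_of_not_commute fun h : Commute y x => hxy h.symm
  have h1 : Commute (x * s) s := hxs.mul_left (.refl s)
  have h2 : ¬Commute (y * t) s := fun h =>
    hst ((commute_mul_iff_of_commute_left hys).1 h).symm
  have hxst : ¬Commute (x * s) t := fun h => hst ((commute_mul_iff_of_commute_left hxt).1 h)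
  -- The two noncommuting pairs each contribute a factor `z`, and these cancel.
  have h3 : Commute (x * s) (y * t) := by
    have e1 := D.mul_eq_of_not_commute hxy
    have e2 := D.mul_eq_of_not_commute hst
    have hz' := Subgroup.mem_center_iff.1 D.mem_center
    have : y * t * (x * s) = x * s * (y * t) := by
      calc y * t * (x * s) = y * (t * x) * s := by group
        _ = y * x * (t * s) := by rw [← hxt.eq]; group
        _ = z * (x * y * z) * s * t := by rw [e1, e2]; group
        _ = z * z * x * (y * s) * t := by rw [hz']; group
        _ = x * s * (y * t) := by rw [hz, hys.eq]; group
    exact this.symm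
  -- `hnot` refutes all three cases; the last one because `x * s * (y * t) = x * y * (s * t)` and
  -- `(s * t) ^ 2 = z ^ 3 = z`.
  rcases hT (x * s) (y * t) s (notMem_center_of_not_commute hxst) h3 h1 h2 with h | h | h
  · exact hnot hs2 hxc hxs h
  · exact hnot ht2 hyc hyt h
  · have e : x * s * (y * t) = x * y * (s * t) := by
      rw [mul_assoc, ← mul_assoc s, ← hys.eq]; group
    have hcm : Commute (x * y) (s * t) :=
      (hxs.mul_left hys).mul_right (hxt.mul_left hyt)
    have hst2 : (s * t) ^ 2 = z := by rw [D.mul_sq_of_not_commute hst, hs2, ht2, hz, mul_one]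
    refine hnot hst2 (x := x * y) (notMem_center_of_not_commute (y := x) fun h' => hxy ?_) hcm
      (e ▸ h)
    exact ((commute_mul_iff_of_commute_left (.refl x)).1 h').symm

/-- Generators of a group in which any two commuting elements that are independent modulo the
center generate a subgroup containing `z`. -/
theorem exists_generators (D : CommutatorsMemZPowers 2 z) (hnc : ∃ x y : G, ¬Commute x y)
    (hI : ∀ s t : G, ¬Commute s t → ∃ x ∉ Subgroup.center G, Commute x s ∧ Commute x t)
    (hT : ∀ x y g : G, x ∉ Subgroup.center G → Commute x y → Commute x g → ¬Commute y g →
      x ^ 2 = z ∨ y ^ 2 = z ∨ (x * y) ^ 2 = z) :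
    ∃ x y u v : G, ¬Commute x y ∧ ¬Commute u v ∧ (Commute x u ∧ Commute x v) ∧
      (Commute y u ∧ Commute y v) ∧ x ^ 2 = z ∧ y ^ 2 = z ∧ u ^ 2 = 1 ∧
      ∀ g, ∃ m ∈ Subgroup.closure {x, y} ⊔ Subgroup.closure {u, v},
        g * m ∈ Subgroup.center G := by
  have hz1 := D.ne_one
  obtain ⟨u, hu, hu2⟩ := D.exists_sq_eq_one hnc hI hT
  obtain ⟨v, huv⟩ := exists_not_commute_of_notMem_center hu
  obtain ⟨x, hx, hxu, hxv⟩ := hI u v huv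
  have hsq (a : G) (ha : a ∉ Subgroup.center G) (hau : Commute a u) (hav : Commute a v) :
      a ^ 2 = z := by
    obtain ⟨b, hab, hbu, -⟩ := D.exists_not_commute_of_commute huv ha hau hav
    rcases hT u a b hu hau.symm hbu.symm hab with h | h | h
    · exact absurd (h.symm.trans hu2) hz1
    · exact h
    · rwa [hau.symm.mul_pow, hu2, one_mul] at h
  obtain ⟨y, hxy, hyu, hyv⟩ := D.exists_not_commute_of_commute huv hx hxu hxv
  have hx2 := hsq x hx hxu hxv
  have hy := notMem_center_of_not_commute fun h : Commute y x => hxy h.symm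
  refine ⟨x, y, u, v, hxy, huv, ⟨hxu, hxv⟩, ⟨hyu, hyv⟩, hx2, hsq y hy hyu hyv, hu2, fun g => ?_⟩
  obtain ⟨m, hm, hmu, hmv⟩ := D.exists_mul_commute huv g
  obtain ⟨n, hn, hnx, hny⟩ := D.exists_mul_commute hxy (g * m)
  have hnu : Commute (g * m * n) u :=
    hmu.mul_left (commute_of_mem_closure_pair hn hxu.symm hyu.symm).symm
  have hnv : Commute (g * m * n) v :=
    hmv.mul_left (commute_of_mem_closure_pair hn hxv.symm hyv.symm).symm
  refine ⟨m * n, mul_mem (Subgroup.mem_sup_right hm) (Subgroup.mem_sup_left hn), ?_⟩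
  rw [← mul_assoc]
  -- If the corrected element `w` were noncentral, `w` and `w * x` would both square to `z`; as `x ^
  -- 2 = z` too and `w` commutes with `x`, this gives `z = 1`.
  by_contra hc
  have h1 := hsq _ hc hnu hnv
  have h2 : (g * m * n * x) ^ 2 = z := by
    refine hsq _ (notMem_center_of_not_commute (y := y) fun h => hxy ?_) (hnu.mul_left hxu)
      (hnv.mul_left hxv)
    exact (commute_mul_iff_of_commute_left hny).1 h
  rw [hnx.mul_pow, h1, hx2] at h2
  exact hz1 (by simpa using h2)

end CommutatorsMemZPowers

/-- `z` is a product of powers of `x ^ 2` and `y ^ 2`. These are central, so the exponents matter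
only modulo two, and both even is excluded by `z ≠ 1`. -/
theorem sq_eq_or_of_commute {G : Type*} [Group G] [Finite G] {z : G} (hG : IsPGroup 2 G)
    (hebr : ebr 2 G = 1) (hsbr : sbr 2 G = 1) (D : CommutatorsMemZPowers 2 z)
    (hZ : ∀ t ∈ Subgroup.center G, t ^ 2 = 1) {x y g : G} (hx : x ∉ Subgroup.center G)
    (hxy : Commute x y) (hxg : Commute x g) (hyg : ¬Commute y g) :
    x ^ 2 = z ∨ y ^ 2 = z ∨ (x * y) ^ 2 = z := by
  obtain ⟨i, j, h⟩ := D.exists_eq_pow_zpow_mul_pow_zpow hxy hxg hyg hx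
    (mem_closure_pair_of_not_commute hG hebr hsbr D hxg hyg hx) D.mem_center
  rw [hxy.mul_pow]
  rcases zpow_eq_one_or_eq_of_sq_eq_one (hZ _ (D.pow_mem_center x)) i with h1 | h1 <;>
    rcases zpow_eq_one_or_eq_of_sq_eq_one (hZ _ (D.pow_mem_center y)) j with h2 | h2 <;> rw [h1, h2] at h
  · exact absurd (by simpa using h) D.ne_one
  · exact .inr (.inl (by simpa using h.symm))
  · exact .inl (by simpa using h.symm)
  · exact .inr (.inr h.symm)

/-! ### Derived subgroups of order two and recognition of central products -/

namespace CommutatorsMemZPowers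

theorem of_swap {G : Type*} [Group G] {z : G} (hz : ∀ g, g * z = z * g) (hz2 : z ^ 2 = 1)
    (hz1 : z ≠ 1) (h : ∀ x y : G, y * x = x * y ∨ y * x = z * (x * y)) :
    CommutatorsMemZPowers 2 z where
  mem_center := Subgroup.mem_center_iff.2 hz
  orderOf_eq := orderOf_eq_prime hz2 hz1
  swap x y := by
    rcases h x y with h | h
    · exact ⟨1, one_mem _, by rw [h, one_mul]⟩
    · exact ⟨z, Subgroup.mem_zpowers z, h⟩

theorem commutator_eq {p : ℕ} [Fact p.Prime] {G : Type*} [Group G] {z : G}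
    (D : CommutatorsMemZPowers p z) (hnc : ∃ x y : G, ¬Commute x y) :
    commutator G = Subgroup.zpowers z := by
  have hmem (x y : G) : ⁅x, y⁆ ∈ Subgroup.zpowers z := by
    obtain ⟨c, hc, h⟩ := D.swap y x
    have : ⁅x, y⁆ = c := by rw [commutatorElement_def, h]; group
    exact this ▸ hc
  apply le_antisymm
  · exact Subgroup.commutator_le.2 fun x _ y _ => hmem x y
  · obtain ⟨x, y, hxy⟩ := hnc
    obtain ⟨k, hk⟩ := D.exists_eq_pow (hmem x y)
      (fun h => hxy (commutatorElement_eq_one_iff_mul_comm.1 h)) (Subgroup.mem_zpowers z)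
    rw [Subgroup.zpowers_le, hk]
    exact pow_mem (Subgroup.commutator_mem_commutator (Subgroup.mem_top _) (Subgroup.mem_top _)) k

theorem commutator_le_center {p : ℕ} [Fact p.Prime] {G : Type*} [Group G] {z : G}
    (D : CommutatorsMemZPowers p z) (hnc : ∃ x y : G, ¬Commute x y) :
    commutator G ≤ Subgroup.center G :=
  D.commutator_eq hnc ▸ D.zpowers_le_center

theorem eq_one_or_eq_of_mem_zpowers {G : Type*} [Group G] {z : G}
    (D : CommutatorsMemZPowers 2 z) {c : G} (hc : c ∈ Subgroup.zpowers z) : c = 1 ∨ c = z := by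
  obtain ⟨k, rfl⟩ := hc
  exact zpow_eq_one_or_eq_of_sq_eq_one D.sq_eq_one k

theorem exists_commutator_mulEquiv {A B : Type*} [Group A] [Group B] {s : A} {t : B}
    (DA : CommutatorsMemZPowers 2 s) (DB : CommutatorsMemZPowers 2 t)
    (hA : ∃ x y : A, ¬Commute x y) (hB : ∃ x y : B, ¬Commute x y) :
    ∃ θ : commutator A ≃* commutator B, ∀ x, (x = 1 ∧ θ x = 1) ∨ ((x : A) = s ∧ (θ x : B) = t) := by
  have hcA : Nat.card (commutator A) = 2 := by
    rw [DA.commutator_eq hA, Nat.card_zpowers, DA.orderOf_eq]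
  have hcB : Nat.card (commutator B) = 2 := by
    rw [DB.commutator_eq hB, Nat.card_zpowers, DB.orderOf_eq]
  refine ⟨mulEquivOfPrimeCardEq hcA hcB, fun x => ?_⟩
  have hx : (x : A) ∈ Subgroup.zpowers s := (DA.commutator_eq hA).le x.2
  have hθx := (DB.commutator_eq hB).le (mulEquivOfPrimeCardEq hcA hcB x).2
  rcases DA.eq_one_or_eq_of_mem_zpowers hx with h | h
  · obtain rfl : x = 1 := Subtype.ext h
    exact .inl ⟨rfl, map_one _⟩
  · refine .inr ⟨h, ?_⟩
    refine (DB.eq_one_or_eq_of_mem_zpowers hθx).resolve_left fun h1 => DA.ne_one ?_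
    rw [← h]
    have h2 := (map_eq_one_iff _ (MulEquiv.injective _)).1 (Subtype.ext h1)
    rw [h2]
    rfl

theorem not_commute_map {G H : Type*} [Group G] [Group H] {z : G}
    (D : CommutatorsMemZPowers 2 z) {k : G →* H} (hk : k z ≠ 1) {a b : G} (h : ¬Commute a b) :
    ¬Commute (k a) (k b) := fun hc => by
  have := congrArg k (D.mul_eq_of_not_commute h)
  simp only [map_mul] at this
  rw [hc.eq] at this
  exact hk (by simpa using this)

end CommutatorsMemZPowers

/-- Recognition of `E × (A * B)` inside a group, for groups `A` and `B` with derived subgroups of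
order two. -/
theorem exists_mulEquiv_prod_centralProduct {E A B G : Type*} [Group E] [Group A] [Group B]
    [Group G] {s : A} {t : B} (DA : CommutatorsMemZPowers 2 s) (DB : CommutatorsMemZPowers 2 t)
    (hA : ∀ a, a = 1 ∨ a = s ∨ ∃ a' : A, ¬Commute a a')
    {W : Subgroup B} (hB : ∀ b, b ∈ W ∨ ∃ b', ¬Commute b b')
    (hA' : ∃ x y : A, ¬Commute x y) (hB' : ∃ x y : B, ¬Commute x y)
    (h : E →* G) (f : A →* G) (g : B →* G) (hst : f s = g t) (hs1 : f s ≠ 1)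
    (hfg : ∀ a b, Commute (f a) (g b)) (hh : ∀ e x, Commute (h e) x)
    (hW : ∀ e, ∀ b ∈ W, h e * g b = 1 → e = 1 ∧ b = 1)
    (htop : ∀ x, x ∈ h.range ⊔ (f.range ⊔ g.range)) :
    ∃ θ : commutator A ≃* commutator B, Nonempty (G ≃* E × CentralProduct A B θ) := by
  obtain ⟨θ, hθ⟩ := DA.exists_commutator_mulEquiv DB hA' hB'
  have hfgθ (x : commutator A) : f x = g (θ x) := by
    rcases hθ x with ⟨rfl, h⟩ | ⟨h1, h2⟩
    · rw [h]; simp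
    · rw [h1, h2, hst]
  have hker : centralProductKernel θ ≤ (f.noncommCoprod g hfg).ker := by
    refine Subgroup.normalClosure_le_normal ?_
    rintro _ ⟨x, rfl⟩
    simp [MonoidHom.mem_ker, hfgθ]
  let φ : CentralProduct A B θ →* G := QuotientGroup.lift _ (f.noncommCoprod g hfg) hker
  have hφ (a b) : φ (QuotientGroup.mk (a, b)) = f a * g b := rfl
  let Φ : E × CentralProduct A B θ →* G := h.noncommCoprod φ fun e _ => hh e _
  have hΦ (e) (q) : Φ (e, q) = h e * φ q := rfl
  have hinj : Function.Injective Φ := by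
    rw [injective_iff_map_eq_one]
    rintro ⟨e, q⟩ hq
    obtain ⟨⟨a, b⟩, rfl⟩ := QuotientGroup.mk_surjective q
    rw [hΦ, hφ] at hq
    -- By `hq`, `f a` is a product of elements commuting with the image of `f`. As `f s ≠ 1`,
    -- noncommuting elements stay noncommuting under `f`, so `a` is central.
    have ha : a = 1 ∨ a = s := by
      rcases hA a with h1 | h1 | ⟨a', h1⟩
      · exact .inl h1
      · exact .inr h1
      · refine absurd ?_ (DA.not_commute_map hs1 h1)
        have : f a = (h e)⁻¹ * (g b)⁻¹ := by
          rw [eq_mul_inv_iff_mul_eq, ← mul_one (h e)⁻¹, eq_inv_mul_iff_mul_eq]; exact hq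
        rw [this]
        exact (hh e _).inv_left.mul_left (hfg a' b).symm.inv_left
    -- A factor `s` is absorbed into `B` as `t`, since the two are identified in the quotient.
    obtain ⟨b', hb', hb2⟩ : ∃ b', (QuotientGroup.mk (a, b) : CentralProduct A B θ) =
        QuotientGroup.mk (1, b') ∧ f a * g b = g b' := by
      rcases ha with rfl | rfl
      · exact ⟨b, rfl, by simp⟩
      · have hs : a ∈ commutator A := by
          rw [DA.commutator_eq hA']
          exact Subgroup.mem_zpowers a
        have ht : (θ ⟨a, hs⟩ : B) = t := by
          rcases hθ ⟨a, hs⟩ with ⟨h1, -⟩ | ⟨-, h1⟩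
          · exact absurd (congrArg Subtype.val h1) DA.ne_one
          · exact h1
        refine ⟨t * b, ?_, by rw [map_mul, hst]⟩
        rw [eq_comm, QuotientGroup.eq]
        refine Subgroup.subset_normalClosure ⟨⟨a, hs⟩, Prod.ext (by simp) ?_⟩
        have := Subgroup.mem_center_iff.1 (inv_mem DB.mem_center) b⁻¹
        simp [ht, this]
    rw [hb2] at hq
    have hbW : b' ∈ W := by
      refine (hB b').resolve_right ?_
      rintro ⟨b'', h1⟩
      refine DB.not_commute_map (hst ▸ hs1) h1 ?_
      rw [eq_inv_of_mul_eq_one_right hq]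
      exact (hh e _).inv_left
    obtain ⟨rfl, rfl⟩ := hW e b' hbW hq
    rw [hb']
    rfl
  have hsurj : Function.Surjective Φ := by
    rw [← MonoidHom.range_eq_top, eq_top_iff]
    intro x _
    refine (sup_le ?_ (sup_le ?_ ?_) : h.range ⊔ (f.range ⊔ g.range) ≤ Φ.range) (htop x)
    · rintro _ ⟨e, rfl⟩
      exact ⟨(e, 1), by rw [hΦ, map_one, mul_one]⟩
    · rintro _ ⟨a, rfl⟩
      exact ⟨(1, QuotientGroup.mk (a, 1)), by rw [hΦ, hφ]; simp⟩
    · rintro _ ⟨b, rfl⟩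
      exact ⟨(1, QuotientGroup.mk (1, b)), by rw [hΦ, hφ]; simp⟩
  exact ⟨θ, ⟨(MulEquiv.ofBijective Φ ⟨hinj, hsurj⟩).symm⟩⟩

/-! ### The exceptional groups have center of index at least eight -/

theorem two_mul_index_le_index {G : Type*} [Group G] [Finite G] {H K : Subgroup G} (h : H < K) :
    2 * K.index ≤ H.index := by
  obtain ⟨k, hk⟩ := Subgroup.index_dvd_of_le h.le
  have := Subgroup.index_strictAnti h
  rw [hk] at this ⊢
  rw [mul_comm]
  refine Nat.mul_le_mul_left _ ?_
  by_contra! hk2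
  interval_cases k <;> omega

/-- The chain `Z(G) < C(x) ∩ C(a) < C(x) < G` has three strict steps, each at least doubling the
index. -/
theorem eight_le_index_center {G : Type*} [Group G] [Finite G] {x y a b : G}
    (hxy : ¬Commute x y) (hab : ¬Commute a b) (hxa : Commute x a) (hxb : Commute x b) :
    8 ≤ (Subgroup.center G).index := by
  have h1 : Subgroup.center G < Subgroup.centralizer {x} ⊓ Subgroup.centralizer {a} := by
    refine lt_of_le_of_ne (le_inf (Subgroup.center_le_centralizer _)
      (Subgroup.center_le_centralizer _)) fun h => notMem_center_of_not_commute hxy ?_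
    rw [h]
    exact ⟨mem_centralizer_singleton_iff_commute.2 (.refl x),
      mem_centralizer_singleton_iff_commute.2 hxa⟩
  have h2 : Subgroup.centralizer {x} ⊓ Subgroup.centralizer {a} < Subgroup.centralizer {x} := by
    refine lt_of_le_of_ne inf_le_left fun h => hab ?_
    have hb := mem_centralizer_singleton_iff_commute.2 hxb.symm
    rw [← h] at hb
    exact (mem_centralizer_singleton_iff_commute.1 hb.2).symm
  have h3 : Subgroup.centralizer {x} < ⊤ := by
    refine lt_of_le_of_ne le_top fun h => hxy ?_
    exact (mem_centralizer_singleton_iff_commute.1 (h ▸ Subgroup.mem_top y)).symm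
  have h1 := two_mul_index_le_index h1
  have h2 := two_mul_index_le_index h2
  have h3 := two_mul_index_le_index h3
  rw [Subgroup.index_top] at h3
  omega

theorem eight_le_index_center_of_mulEquiv {E A B G : Type*} [Group E] [Group A] [Group B]
    [Group G] [Finite G] {s : A} {t : B} (DA : CommutatorsMemZPowers 2 s)
    (DB : CommutatorsMemZPowers 2 t) (hA : ∃ x y : A, ¬Commute x y)
    (hB : ∃ x y : B, ¬Commute x y) (θ : commutator A ≃* commutator B)
    (e : G ≃* E × CentralProduct A B θ) : 8 ≤ (Subgroup.center G).index := by
  have hker := mem_centralProductKernel_iff θ (DA.commutator_le_center hA)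
    (DB.commutator_le_center hB)
  let φ : A × B →* G :=
    e.symm.toMonoidHom.comp ((MonoidHom.inr _ _).comp (QuotientGroup.mk' _))
  have hφ (y z : A × B) : φ y = φ z ↔ y⁻¹ * z ∈ centralProductKernel θ := by
    rw [← QuotientGroup.eq]
    simp [φ]
  obtain ⟨x, y, hxy⟩ := hA
  obtain ⟨a, b, hab⟩ := hB
  have hcomm (x : A) (a : B) : Commute (φ (x, 1)) (φ (1, a)) := by
    simp [Commute, SemiconjBy, ← map_mul]
  refine eight_le_index_center (x := φ (x, 1)) (y := φ (y, 1)) (a := φ (1, a)) (b := φ (1, b))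
    (fun h => hxy ?_) (fun h => hab ?_) (hcomm x a) (hcomm x b)
  -- An element of the kernel with one trivial coordinate is trivial, because `θ` is injective; so
  -- both factors embed.
  · rw [Commute, SemiconjBy, ← map_mul, ← map_mul, hφ, hker] at h
    obtain ⟨c, hc⟩ := h
    simp only [Prod.mk_mul_mk, Prod.inv_mk, Prod.mk.injEq, mul_one, inv_one] at hc
    obtain ⟨h1, h2⟩ := hc
    have : c = 1 := by simpa using h2.symm
    rw [this] at h1
    exact inv_mul_eq_one.1 h1
  · rw [Commute, SemiconjBy, ← map_mul, ← map_mul, hφ, hker] at h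
    obtain ⟨c, hc⟩ := h
    simp only [Prod.mk_mul_mk, Prod.inv_mk, Prod.mk.injEq, mul_one, inv_one] at hc
    obtain ⟨h1, h2⟩ := hc
    have : c = 1 := by simpa using h1.symm
    rw [this] at h2
    exact inv_mul_eq_one.1 (by simpa using h2)

/-! ### Complements in an elementary abelian center -/

/-- A complement in an elementary abelian `2`-group. -/
theorem exists_elemAbelianTwo_isCompl {Z : Type*} [CommGroup Z] [Finite Z]
    (hZ : ∀ x : Z, x ^ 2 = 1) (W : Subgroup Z) :
    ∃ (n : ℕ) (h : ElemAbelianTwo n →* Z), Function.Injective h ∧ IsCompl h.range W := by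
  let : Module (ZMod 2) (Additive Z) := AddCommGroup.zmodModule (n := 2) fun x => hZ x.toMul
  obtain ⟨Q, hQ⟩ := Submodule.exists_isCompl (AddSubgroup.toZModSubmodule 2 W.toAddSubgroup)
  have : Module.Finite (ZMod 2) Q := inferInstance
  let e := (Module.finBasis (ZMod 2) Q).equivFun.symm
  let h : ElemAbelianTwo (Module.finrank (ZMod 2) Q) →* Z :=
    MonoidHom.mk' (fun v => (e (fun i => (v i).toAdd) : Additive Z).toMul) fun v w => by
      rw [← toMul_add, ← Submodule.coe_add, ← map_add]
      rfl
  have hr (x : Z) : x ∈ h.range ↔ Additive.ofMul x ∈ Q := by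
    constructor
    · rintro ⟨v, rfl⟩
      exact Subtype.property _
    · intro hx
      refine ⟨fun i => .ofAdd (e.symm ⟨_, hx⟩ i), ?_⟩
      change (e (e.symm ⟨_, hx⟩) : Additive Z).toMul = x
      rw [LinearEquiv.apply_symm_apply]
      rfl
  refine ⟨_, h, fun v w hvw => ?_, ?_⟩
  · exact e.injective (Subtype.ext hvw)
  · constructor
    · rw [Subgroup.disjoint_def]
      intro x hx hxW
      exact (Submodule.disjoint_def.1 hQ.disjoint (Additive.ofMul x) hxW ((hr x).1 hx))
    · rw [codisjoint_iff, eq_top_iff]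
      intro x _
      obtain ⟨w, hw, q, hq, hwq⟩ := Submodule.mem_sup.1
        (hQ.codisjoint.eq_top ▸ Submodule.mem_top (x := Additive.ofMul x))
      have : x = q.toMul * w.toMul := by
        rw [mul_comm]
        exact hwq.symm
      rw [this]
      exact mul_mem (Subgroup.mem_sup_left ((hr _).2 hq)) (Subgroup.mem_sup_right hw)

theorem exists_elemAbelianTwo_center {G : Type*} [Group G] [Finite G]
    (hZ : ∀ x ∈ Subgroup.center G, x ^ 2 = 1) {W : Subgroup G} (hW : W ≤ Subgroup.center G) :
    ∃ (n : ℕ) (h : ElemAbelianTwo n →* G), Function.Injective h ∧ Disjoint h.range W ∧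
      h.range ⊔ W = Subgroup.center G := by
  let : CommGroup (Subgroup.center G) :=
    { (inferInstance : Group (Subgroup.center G)) with mul_comm := mul_comm' }
  obtain ⟨n, h, hinj, hc⟩ := exists_elemAbelianTwo_isCompl
    (fun x : Subgroup.center G => Subtype.ext (hZ x x.2)) (W.subgroupOf (Subgroup.center G))
  refine ⟨n, (Subgroup.center G).subtype.comp h, Subtype.val_injective.comp hinj, ?_, ?_⟩
  · rw [Subgroup.disjoint_def]
    rintro _ ⟨v, rfl⟩ hv
    exact congrArg Subtype.val (Subgroup.disjoint_def.1 hc.disjoint ⟨v, rfl⟩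
      (Subgroup.mem_subgroupOf.2 hv))
  · have := congrArg (Subgroup.map (Subgroup.center G).subtype) hc.sup_eq_top
    rw [Subgroup.map_sup, Subgroup.subgroupOf_map_subtype, inf_eq_left.2 hW,
      MonoidHom.map_range, ← MonoidHom.range_eq_map, Subgroup.range_subtype] at this
    exact this

/-! ### Homomorphisms out of dihedral and quaternion groups -/

section Lifts

variable {G : Type*} [Group G]

/-- The homomorphism from `ℤ/n` to a group that sends `1` to an element with `y ^ n = 1`. -/
def zmodPowHom (n : ℕ) (y : G) (hy : y ^ n = 1) : ZMod n →+ Additive G :=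
  ZMod.lift n ⟨zmultiplesHom (Additive G) (Additive.ofMul y), by
    rw [zmultiplesHom_apply, ← ofMul_zpow, zpow_natCast, hy]; rfl⟩

variable {n : ℕ} {y : G} (hy : y ^ n = 1)

theorem zmodPowHom_intCast (k : ℤ) : (zmodPowHom n y hy k).toMul = y ^ k := by
  rw [zmodPowHom, ZMod.lift_coe]
  rfl

theorem toMul_zmodPowHom_mul {x : G} (h : y * x = x * y⁻¹) (i : ZMod n) :
    (zmodPowHom n y hy i).toMul * x = x * (zmodPowHom n y hy (-i)).toMul := by
  obtain ⟨k, rfl⟩ := ZMod.intCast_surjective i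
  rw [← Int.cast_neg, zmodPowHom_intCast, zmodPowHom_intCast]
  have : SemiconjBy x y⁻¹ y := h.symm
  simpa using (this.zpow_right k).eq.symm

/-- The homomorphism from a dihedral group given by images of the generators. -/
def dihedralGroupLift {x : G} (hx : x ^ 2 = 1) (h : y * x = x * y⁻¹) : DihedralGroup n →* G :=
  MonoidHom.mk' (fun
    | .r i => (zmodPowHom n y hy i).toMul
    | .sr i => x * (zmodPowHom n y hy i).toMul) (by
    have hm := toMul_zmodPowHom_mul hy h
    rintro (i | i) (j | j)
    · simp only [DihedralGroup.r_mul_r, map_add, toMul_add]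
    · simp only [DihedralGroup.r_mul_sr]
      rw [← mul_assoc, hm, mul_assoc, ← toMul_add, ← map_add, sub_eq_neg_add]
    · simp only [DihedralGroup.sr_mul_r, map_add, toMul_add, mul_assoc]
    · simp only [DihedralGroup.sr_mul_sr]
      rw [mul_assoc, ← mul_assoc _ x, hm, ← mul_assoc, ← mul_assoc, ← sq, hx, one_mul,
        ← toMul_add, ← map_add, sub_eq_neg_add])

theorem dihedralGroupLift_mem {x : G} (hx : x ^ 2 = 1) (h : y * x = x * y⁻¹)
    (g : DihedralGroup n) : dihedralGroupLift hy hx h g ∈ Subgroup.closure {y, x} := by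
  have hX : x ∈ Subgroup.closure {y, x} := Subgroup.subset_closure (by simp)
  have hY (i : ZMod n) : (zmodPowHom n y hy i).toMul ∈ Subgroup.closure {y, x} := by
    obtain ⟨k, rfl⟩ := ZMod.intCast_surjective i
    rw [zmodPowHom_intCast]
    exact zpow_mem (Subgroup.subset_closure (by simp)) k
  rcases g with i | i
  · exact hY i
  · exact mul_mem hX (hY i)

theorem dihedralGroupLift_r {x : G} (hx : x ^ 2 = 1) (h : y * x = x * y⁻¹) (k : ℤ) :
    dihedralGroupLift hy hx h (.r k) = y ^ k :=
  zmodPowHom_intCast hy k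

theorem dihedralGroupLift_sr_zero {x : G} (hx : x ^ 2 = 1) (h : y * x = x * y⁻¹) :
    dihedralGroupLift hy hx h (.sr 0) = x := by
  change x * (zmodPowHom n y hy 0).toMul = x
  rw [map_zero, toMul_zero, mul_one]

theorem range_dihedralGroupLift {x : G} (hx : x ^ 2 = 1) (h : y * x = x * y⁻¹) :
    (dihedralGroupLift hy hx h).range = Subgroup.closure {y, x} := by
  apply le_antisymm
  · rintro _ ⟨g, rfl⟩
    exact dihedralGroupLift_mem hy hx h g
  · rw [Subgroup.closure_le]
    rintro _ (rfl | rfl)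
    · exact ⟨_, (dihedralGroupLift_r hy hx h 1).trans (zpow_one _)⟩
    · exact ⟨_, dihedralGroupLift_sr_zero hy hx h⟩

/-- The homomorphism from a quaternion group given by images of the generators. -/
def quaternionGroupLift {y : G} (hy : y ^ (2 * n) = 1) {x : G} (hx : x ^ 2 = y ^ n)
    (h : y * x = x * y⁻¹) : QuaternionGroup n →* G :=
  MonoidHom.mk' (fun
    | .a i => (zmodPowHom (2 * n) y hy i).toMul
    | .xa i => x * (zmodPowHom (2 * n) y hy i).toMul) (by
    have hm := toMul_zmodPowHom_mul hy h
    rintro (i | i) (j | j)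
    · simp only [QuaternionGroup.a_mul_a, map_add, toMul_add]
    · simp only [QuaternionGroup.a_mul_xa]
      rw [← mul_assoc, hm, mul_assoc, ← toMul_add, ← map_add, sub_eq_neg_add]
    · simp only [QuaternionGroup.xa_mul_a, map_add, toMul_add, mul_assoc]
    · simp only [QuaternionGroup.xa_mul_xa]
      have hn := zmodPowHom_intCast hy n
      rw [zpow_natCast, Int.cast_natCast] at hn
      rw [mul_assoc, ← mul_assoc _ x, hm, ← mul_assoc, ← mul_assoc, ← sq, hx, ← hn, ← toMul_add,
        ← map_add, ← toMul_add, ← map_add]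
      congr 2
      ring)

theorem quaternionGroupLift_mem {y : G} (hy : y ^ (2 * n) = 1) {x : G} (hx : x ^ 2 = y ^ n)
    (h : y * x = x * y⁻¹) (g : QuaternionGroup n) :
    quaternionGroupLift hy hx h g ∈ Subgroup.closure {y, x} := by
  have hX : x ∈ Subgroup.closure {y, x} := Subgroup.subset_closure (by simp)
  have hY (i : ZMod (2 * n)) : (zmodPowHom (2 * n) y hy i).toMul ∈ Subgroup.closure {y, x} := by
    obtain ⟨k, rfl⟩ := ZMod.intCast_surjective i
    rw [zmodPowHom_intCast]
    exact zpow_mem (Subgroup.subset_closure (by simp)) k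
  rcases g with i | i
  · exact hY i
  · exact mul_mem hX (hY i)

theorem quaternionGroupLift_a {y : G} (hy : y ^ (2 * n) = 1) {x : G} (hx : x ^ 2 = y ^ n)
    (h : y * x = x * y⁻¹) (k : ℤ) : quaternionGroupLift hy hx h (.a k) = y ^ k :=
  zmodPowHom_intCast hy k

theorem quaternionGroupLift_xa_zero {y : G} (hy : y ^ (2 * n) = 1) {x : G} (hx : x ^ 2 = y ^ n)
    (h : y * x = x * y⁻¹) : quaternionGroupLift hy hx h (.xa 0) = x := by
  change x * (zmodPowHom (2 * n) y hy 0).toMul = x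
  rw [map_zero, toMul_zero, mul_one]

theorem range_quaternionGroupLift {y : G} (hy : y ^ (2 * n) = 1) {x : G} (hx : x ^ 2 = y ^ n)
    (h : y * x = x * y⁻¹) : (quaternionGroupLift hy hx h).range = Subgroup.closure {y, x} := by
  apply le_antisymm
  · rintro _ ⟨g, rfl⟩
    exact quaternionGroupLift_mem hy hx h g
  · rw [Subgroup.closure_le]
    rintro _ (rfl | rfl)
    · exact ⟨_, (quaternionGroupLift_a hy hx h 1).trans (zpow_one _)⟩
    · exact ⟨_, quaternionGroupLift_xa_zero hy hx h⟩

end Lifts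

/-! ### The factors `Q_8`, `D_8` and `P_{2,1,1}` -/

namespace QuaternionGroup

theorem commutatorsMemZPowers : CommutatorsMemZPowers 2 (a 2 : QuaternionGroup 2) :=
  .of_swap (by decide) (by decide) (by decide) (by decide)

theorem eq_one_or_eq_or_exists_not_commute (g : QuaternionGroup 2) :
    g = 1 ∨ g = a 2 ∨ ∃ h, ¬Commute g h := by
  have : ∀ g : QuaternionGroup 2, g = 1 ∨ g = a 2 ∨ ∃ h, ¬g * h = h * g := by decide
  exact this g

theorem exists_not_commute : ∃ g h : QuaternionGroup 2, ¬Commute g h := by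
  have : ∃ g h : QuaternionGroup 2, ¬g * h = h * g := by decide
  exact this

end QuaternionGroup

namespace DihedralGroup

theorem commutatorsMemZPowers : CommutatorsMemZPowers 2 (r 2 : DihedralGroup 4) :=
  .of_swap (by decide) (by decide) (by decide) (by decide)

theorem mem_or_exists_not_commute (g : DihedralGroup 4) :
    g ∈ Subgroup.zpowers (r 2 : DihedralGroup 4) ∨ ∃ h, ¬Commute g h := by
  have : ∀ g : DihedralGroup 4, g = 1 ∨ g = r 2 ∨ ∃ h, ¬g * h = h * g := by decide
  rcases this g with rfl | rfl | h
  · exact .inl (one_mem _)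
  · exact .inl (Subgroup.mem_zpowers _)
  · exact .inr h

theorem exists_not_commute : ∃ g h : DihedralGroup 4, ¬Commute g h := by
  have : ∃ g h : DihedralGroup 4, ¬g * h = h * g := by decide
  exact this

end DihedralGroup

namespace GroupP

/-- The homomorphism from `P_{2,1,1}` given by images of the generators. -/
def lift {G : Type*} [Group G] {a b c : G} (ha : a ^ 4 = 1) (hb : b ^ 2 = 1) (hc : c ^ 2 = 1)
    (hab : Commute a b) (hbc : Commute b c) (hac : a * c = b * (c * a)) : GroupP 2 2 1 →* G :=
  PresentedGroup.toGroup (f := ![a, b, c]) (by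
    rintro _ (rfl | rfl | rfl | rfl | rfl | rfl)
    · simpa using ha
    · simpa using hb
    · simpa using hc
    · simpa using commutatorElement_eq_one_iff_commute.2 hab
    · simpa using commutatorElement_eq_one_iff_commute.2 hbc
    · simp only [map_mul, map_inv, commutatorElement_def, FreeGroup.lift_apply_of]
      change a * c * a⁻¹ * c⁻¹ * b⁻¹ = 1
      rw [hac]
      group)

/-- The generator `a`. -/
def genA : GroupP 2 2 1 := PresentedGroup.of 0

/-- The generator `b`. -/
def genB : GroupP 2 2 1 := PresentedGroup.of 1

/-- The generator `c`. -/
def genC : GroupP 2 2 1 := PresentedGroup.of 2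

section

variable {G : Type*} [Group G] {a b c : G} (ha : a ^ 4 = 1) (hb : b ^ 2 = 1) (hc : c ^ 2 = 1)
  (hab : Commute a b) (hbc : Commute b c) (hac : a * c = b * (c * a))

theorem lift_genA : lift ha hb hc hab hbc hac genA = a := PresentedGroup.toGroup.of _

theorem lift_genB : lift ha hb hc hab hbc hac genB = b := PresentedGroup.toGroup.of _

theorem lift_genC : lift ha hb hc hab hbc hac genC = c := PresentedGroup.toGroup.of _

end

theorem genA_pow : genA ^ 4 = 1 :=
  PresentedGroup.one_of_mem (rels := relatorsP 2 2 1) (.inl rfl)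

theorem genB_sq : genB ^ 2 = 1 :=
  PresentedGroup.one_of_mem (rels := relatorsP 2 2 1) (.inr (.inl rfl))

theorem genC_sq : genC ^ 2 = 1 :=
  PresentedGroup.one_of_mem (rels := relatorsP 2 2 1) (.inr (.inr (.inl rfl)))

theorem commute_genA_genB : Commute genA genB :=
  commutatorElement_eq_one_iff_commute.1
    (PresentedGroup.one_of_mem (rels := relatorsP 2 2 1) (.inr (.inr (.inr (.inl rfl)))))

theorem commute_genB_genC : Commute genB genC :=
  commutatorElement_eq_one_iff_commute.1
    (PresentedGroup.one_of_mem (rels := relatorsP 2 2 1) (.inr (.inr (.inr (.inr (.inl rfl))))))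

theorem genA_mul_genC : genA * genC = genB * (genC * genA) := by
  have h : ⁅genA, genC⁆ * genB⁻¹ = 1 :=
    PresentedGroup.one_of_mem (rels := relatorsP 2 2 1) (.inr (.inr (.inr (.inr (.inr rfl)))))
  rw [← mul_inv_eq_one.1 h, commutatorElement_def]
  group

theorem closure_eq_top : Subgroup.closure {genA, genC} = ⊤ := by
  have hA : genA ∈ Subgroup.closure {genA, genC} := Subgroup.subset_closure (by simp)
  have hC : genC ∈ Subgroup.closure {genA, genC} := Subgroup.subset_closure (by simp)
  rw [eq_top_iff, ← PresentedGroup.closure_range_of, Subgroup.closure_le]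
  rintro _ ⟨i, rfl⟩
  fin_cases i
  · exact hA
  · have : genB = genA * genC * genA⁻¹ * genC⁻¹ := by rw [genA_mul_genC]; group
    change genB ∈ _
    rw [this]
    exact mul_mem (mul_mem (mul_mem hA hC) (inv_mem hA)) (inv_mem hC)
  · exact hC

theorem mem_center_of_commute {g : GroupP 2 2 1} (hA : Commute g genA) (hC : Commute g genC) :
    g ∈ Subgroup.center (GroupP 2 2 1) := by
  refine Subgroup.mem_center_iff.2 fun x => ?_
  exact (commute_of_mem_closure_pair (closure_eq_top ▸ Subgroup.mem_top x) hA hC).eq.symm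

theorem range_eq_closure {G : Type*} [Group G] (k : GroupP 2 2 1 →* G) :
    k.range = Subgroup.closure {k genA, k genC} := by
  rw [MonoidHom.range_eq_map, ← closure_eq_top, MonoidHom.map_closure, Set.image_pair]

theorem genB_mem_center : genB ∈ Subgroup.center (GroupP 2 2 1) :=
  mem_center_of_commute commute_genA_genB.symm commute_genB_genC

theorem genC_mul_genA : genC * genA = genB * (genA * genC) := by
  rw [genA_mul_genC, ← mul_assoc, ← sq, genB_sq, one_mul]

theorem genA_sq_mem_center : genA ^ 2 ∈ Subgroup.center (GroupP 2 2 1) := by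
  refine mem_center_of_commute (Commute.pow_self _ _) ?_
  have := pow_mul_of_mul_eq genB_mem_center genA_mul_genC 2
  rwa [genB_sq, one_mul] at this

/-- The relations hold in `D_8` with `b` sent to the nontrivial central rotation, so the
presentation does not collapse `b`. -/
theorem genB_ne_one : genB ≠ 1 := by
  intro h
  have := lift_genB (a := DihedralGroup.r (1 : ZMod 4)) (b := .r 2) (c := .sr 0) (by decide)
    (by decide) (by decide) (by unfold Commute SemiconjBy; decide)
    (by unfold Commute SemiconjBy; decide) (by decide)
  rw [h, map_one] at this
  exact absurd this (by decide)

theorem not_commute_genA_genC : ¬Commute genA genC := fun h => genB_ne_one (by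
  have := genA_mul_genC
  rw [h.eq] at this
  simpa using this.symm)

/-- Every element of `P_{2,1,1}` is a product of an element of `⟨a ^ 2, b⟩` with one of `1`, `a`,
`c`, `ac`. -/
theorem exists_eq (g : GroupP 2 2 1) : ∃ w ∈ Subgroup.closure {genA ^ 2, genB},
    g = w ∨ g = w * genA ∨ g = w * genC ∨ g = w * (genA * genC) := by
  have hg : g ∈ Subgroup.closure {genA, genC} := closure_eq_top ▸ Subgroup.mem_top g
  have hA : genA ^ 2 ∈ Subgroup.closure {genA ^ 2, genB} := Subgroup.subset_closure (by simp)
  have hB : genB ∈ Subgroup.closure {genA ^ 2, genB} := Subgroup.subset_closure (by simp)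
  have hAA : genA * genA = genA ^ 2 := (sq _).symm
  have hCC : genC * genC = 1 := by rw [← sq, genC_sq]
  have step : ∀ x ∈ ({genA, genC} : Set (GroupP 2 2 1)), ∀ g,
      (∃ w ∈ Subgroup.closure {genA ^ 2, genB},
      g = w ∨ g = w * genA ∨ g = w * genC ∨ g = w * (genA * genC)) →
      ∃ w ∈ Subgroup.closure {genA ^ 2, genB},
      g * x = w ∨ g * x = w * genA ∨ g * x = w * genC ∨ g * x = w * (genA * genC) := by
    rintro x (rfl | rfl) g ⟨w, hw, h⟩ <;> rcases h with h | h | h | h <;> rw [h]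
    · exact ⟨w, hw, by simp⟩
    · exact ⟨w * genA ^ 2, mul_mem hw hA, .inl (by rw [mul_assoc, hAA])⟩
    · refine ⟨w * genB, mul_mem hw hB, .inr (.inr (.inr ?_))⟩
      rw [mul_assoc, genC_mul_genA]; simp only [mul_assoc]
    · refine ⟨w * genB * genA ^ 2, mul_mem (mul_mem hw hB) hA, .inr (.inr (.inl ?_))⟩
      rw [mul_assoc, mul_assoc genA, genC_mul_genA, ← mul_assoc genA, commute_genA_genB.eq, sq]
      simp only [mul_assoc]
    · exact ⟨w, hw, by simp⟩
    · exact ⟨w, hw, by simp [mul_assoc]⟩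
    · exact ⟨w, hw, by simp [mul_assoc, hCC]⟩
    · exact ⟨w, hw, by simp [mul_assoc, hCC]⟩
  induction hg using Subgroup.closure_induction_right with
  | one => exact ⟨1, one_mem _, by simp⟩
  | mul_right g _ x hx ih => exact step x hx g ih
  | mul_inv_cancel g _ x hx ih =>
    -- Both generators have fourth power `1`, so multiplying by an inverse is three applications of
    -- `step`.
    have h4 : x⁻¹ = x * x * x := by
      rw [inv_eq_iff_mul_eq_one]
      rcases hx with rfl | rfl
      · rw [hAA, ← pow_succ, ← pow_succ', genA_pow]
      · rw [hCC, one_mul, hCC]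
    rw [h4, ← mul_assoc, ← mul_assoc]
    exact step x hx _ (step x hx _ (step x hx _ ih))

theorem commute_map {H : Type*} [Group H] (k : GroupP 2 2 1 →* H) (h : Commute (k genA) (k genC))
    (x y : GroupP 2 2 1) : Commute (k x) (k y) := by
  have key (x : GroupP 2 2 1) (g : H) (hA : Commute (k genA) g) (hC : Commute (k genC) g) :
      Commute (k x) g := by
    have : Subgroup.closure {genA, genC} ≤ (Subgroup.centralizer {g}).comap k := by
      rw [Subgroup.closure_le]
      rintro _ (rfl | rfl)
      · exact mem_centralizer_singleton_iff_commute.2 hA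
      · exact mem_centralizer_singleton_iff_commute.2 hC
    exact mem_centralizer_singleton_iff_commute.1
      (this (closure_eq_top ▸ Subgroup.mem_top x))
  exact key x _ (key y _ (.refl _) h.symm).symm (key y _ h (.refl _)).symm

theorem commutatorsMemZPowers : CommutatorsMemZPowers 2 genB where
  mem_center := genB_mem_center
  orderOf_eq := orderOf_eq_prime genB_sq genB_ne_one
  swap x y := by
    have hn : (Subgroup.zpowers genB).Normal := by
      refine ⟨fun c hc g => ?_⟩
      have := Subgroup.mem_center_iff.1 ((Subgroup.zpowers_le.2 genB_mem_center) hc) g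
      rwa [this, mul_inv_cancel_right]
    refine ⟨y * x * (x * y)⁻¹, ?_, by group⟩
    -- Modulo `⟨b⟩` the generators `a` and `c` commute, so the quotient is abelian.
    rw [← QuotientGroup.ker_mk' (Subgroup.zpowers genB), MonoidHom.mem_ker, map_mul, map_inv,
      mul_inv_eq_one, map_mul, map_mul]
    refine commute_map _ ?_ y x
    rw [Commute, SemiconjBy, ← map_mul, ← map_mul, genA_mul_genC, map_mul]
    have : QuotientGroup.mk' (Subgroup.zpowers genB) genB = 1 := by
      rw [← MonoidHom.mem_ker, QuotientGroup.ker_mk']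
      exact Subgroup.mem_zpowers _
    rw [this, one_mul]

theorem closure_le_center : Subgroup.closure {genA ^ 2, genB} ≤ Subgroup.center (GroupP 2 2 1) := by
  rw [Subgroup.closure_le]
  rintro _ (rfl | rfl)
  · exact genA_sq_mem_center
  · exact genB_mem_center

theorem mem_or_exists_not_commute (g : GroupP 2 2 1) :
    g ∈ Subgroup.closure {genA ^ 2, genB} ∨ ∃ h, ¬Commute g h := by
  obtain ⟨w, hw, h⟩ := exists_eq g
  have hwc (x) : Commute w x := (Subgroup.mem_center_iff.1 (closure_le_center hw) x).symm
  rcases h with rfl | rfl | rfl | rfl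
  · exact .inl hw
  · refine .inr ⟨genC, fun h => not_commute_genA_genC ?_⟩
    exact (commute_mul_iff_of_commute_left (hwc _)).1 h
  · refine .inr ⟨genA, fun h => not_commute_genA_genC ?_⟩
    exact ((commute_mul_iff_of_commute_left (hwc _)).1 h).symm
  · refine .inr ⟨genA, fun h => not_commute_genA_genC ?_⟩
    have := (commute_mul_iff_of_commute_left (hwc _)).1 h
    exact ((commute_mul_iff_of_commute_left (.refl genA)).1 this).symm

end GroupP

/-! ### Assembling the isomorphisms -/

namespace CommutatorsMemZPowers

variable {G : Type*} [Group G] {z : G}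

theorem mul_eq_mul_inv (D : CommutatorsMemZPowers 2 z) {x y : G} (h : ¬Commute x y)
    (hx : x ^ 2 = z) : x * y = y * x⁻¹ := by
  have hxx : x * x = z := by rw [← sq, hx]
  rw [eq_mul_inv_iff_mul_eq, mul_assoc, D.mul_eq_of_not_commute h, ← mul_assoc x,
    Subgroup.mem_center_iff.1 D.mem_center, mul_assoc, ← mul_assoc x, hxx, ← mul_assoc, ← sq,
    D.sq_eq_one, one_mul]

theorem pow_four_eq_one (D : CommutatorsMemZPowers 2 z) {x : G} (hx : x ^ 2 = z) : x ^ 4 = 1 := by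
  rw [show 4 = 2 * 2 from rfl, pow_mul, hx, D.sq_eq_one]

/-- Common to both families: `x` and `y` generate the quaternion factor, `B` maps onto `⟨u, v⟩`, and
the elementary abelian factor is a complement in the center of `G` to the image of `W`. -/
theorem exists_mulEquiv_prod_quaternion [Finite G] (D : CommutatorsMemZPowers 2 z)
    (hZ : ∀ t ∈ Subgroup.center G, t ^ 2 = 1) {x y u v : G} (hxy : ¬Commute x y)
    (hx : Commute x u ∧ Commute x v) (hy : Commute y u ∧ Commute y v) (hx2 : x ^ 2 = z)
    (hy2 : y ^ 2 = z)
    (htop : ∀ g, ∃ m ∈ Subgroup.closure {x, y} ⊔ Subgroup.closure {u, v},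
      g * m ∈ Subgroup.center G)
    {B : Type*} [Group B] {t : B} (DB : CommutatorsMemZPowers 2 t) {W : Subgroup B}
    (hB : ∀ b, b ∈ W ∨ ∃ b', ¬Commute b b') (hB' : ∃ x y : B, ¬Commute x y) (g : B →* G)
    (hg : g.range = Subgroup.closure {u, v}) (hgt : g t = z)
    (hWc : W.map g ≤ Subgroup.center G) (hW : ∀ b ∈ W, g b = 1 → b = 1) :
    ∃ (n : ℕ) (θ : commutator (QuaternionGroup 2) ≃* commutator B),
      Nonempty (G ≃* ElemAbelianTwo n × CentralProduct (QuaternionGroup 2) B θ) := by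
  obtain ⟨n, h, hinj, hdisj, hsup⟩ := exists_elemAbelianTwo_center hZ hWc
  have hx4 : x ^ (2 * 2) = 1 := D.pow_four_eq_one hx2
  have hrel := D.mul_eq_mul_inv hxy hx2
  let f : QuaternionGroup 2 →* G := quaternionGroupLift hx4 (hy2.trans hx2.symm) hrel
  have hf : f.range = Subgroup.closure {x, y} := range_quaternionGroupLift _ _ _
  have hfz : f (.a 2) = z := by
    have := quaternionGroupLift_a hx4 (hy2.trans hx2.symm) hrel 2
    rw [zpow_ofNat] at this
    exact this.trans hx2
  have hhc (e) : h e ∈ Subgroup.center G := hsup ▸ Subgroup.mem_sup_left ⟨e, rfl⟩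
  refine ⟨n, exists_mulEquiv_prod_centralProduct QuaternionGroup.commutatorsMemZPowers DB
    QuaternionGroup.eq_one_or_eq_or_exists_not_commute hB QuaternionGroup.exists_not_commute hB'
    h f g (hfz.trans hgt.symm) (hfz ▸ D.ne_one) (fun a b => ?_)
    (fun e x => (Subgroup.mem_center_iff.1 (hhc e) x).symm) (fun e b hb heb => ?_) fun k => ?_⟩
  · have ha : f a ∈ Subgroup.closure {x, y} := hf ▸ ⟨a, rfl⟩
    have hb : g b ∈ Subgroup.closure {u, v} := hg ▸ ⟨b, rfl⟩
    exact commute_of_mem_closure_pair hb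
      (commute_of_mem_closure_pair ha hx.1.symm hy.1.symm).symm
      (commute_of_mem_closure_pair ha hx.2.symm hy.2.symm).symm
  · have h1 : h e = 1 := by
      refine Subgroup.disjoint_def.1 hdisj ⟨e, rfl⟩ ?_
      rw [eq_inv_of_mul_eq_one_left heb]
      exact inv_mem ⟨b, hb, rfl⟩
    rw [h1, one_mul] at heb
    exact ⟨hinj (h1.trans (map_one h).symm), hW b hb heb⟩
  · obtain ⟨m, hm, hkm⟩ := htop k
    rw [← hf, ← hg] at hm
    rw [← hsup] at hkm
    have hle : h.range ⊔ W.map g ≤ h.range ⊔ (f.range ⊔ g.range) :=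
      sup_le_sup_left ((Subgroup.map_le_range g W).trans le_sup_right) _
    exact (Subgroup.mul_mem_cancel_right _ (Subgroup.mem_sup_right hm)).1 (hle hkm)

theorem exists_mulEquiv_prod_quaternion_dihedral [Finite G] (D : CommutatorsMemZPowers 2 z)
    (hZ : ∀ t ∈ Subgroup.center G, t ^ 2 = 1) {x y u v : G} (hxy : ¬Commute x y)
    (huv : ¬Commute u v) (hx : Commute x u ∧ Commute x v) (hy : Commute y u ∧ Commute y v)
    (hx2 : x ^ 2 = z) (hy2 : y ^ 2 = z) (hu2 : u ^ 2 = 1) (hv2 : v ^ 2 = z)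
    (htop : ∀ g, ∃ m ∈ Subgroup.closure {x, y} ⊔ Subgroup.closure {u, v},
      g * m ∈ Subgroup.center G) :
    ∃ (n : ℕ) (θ : commutator (QuaternionGroup 2) ≃* commutator (DihedralGroup 4)),
      Nonempty (G ≃* ElemAbelianTwo n ×
        CentralProduct (QuaternionGroup 2) (DihedralGroup 4) θ) := by
  have hv4 := D.pow_four_eq_one hv2
  have hrel := D.mul_eq_mul_inv (fun h => huv h.symm) hv2
  have hr2 : dihedralGroupLift hv4 hu2 hrel (.r 2) = z := by
    have := dihedralGroupLift_r hv4 hu2 hrel 2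
    rw [zpow_ofNat, hv2] at this
    exact this
  refine D.exists_mulEquiv_prod_quaternion hZ hxy hx hy hx2 hy2 htop
    DihedralGroup.commutatorsMemZPowers DihedralGroup.mem_or_exists_not_commute
    DihedralGroup.exists_not_commute (dihedralGroupLift hv4 hu2 hrel) ?_ hr2 ?_ ?_
  · rw [range_dihedralGroupLift, Set.pair_comm]
  · rw [MonoidHom.map_zpowers, hr2]
    exact D.zpowers_le_center
  · intro b hb hb1
    refine (DihedralGroup.commutatorsMemZPowers.eq_one_or_eq_of_mem_zpowers hb).resolve_right ?_
    rintro rfl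
    exact D.ne_one (hr2.symm.trans hb1)

theorem exists_mulEquiv_prod_quaternion_groupP [Finite G] (D : CommutatorsMemZPowers 2 z)
    (hZ : ∀ t ∈ Subgroup.center G, t ^ 2 = 1) {x y u v : G} (hxy : ¬Commute x y)
    (huv : ¬Commute u v) (hx : Commute x u ∧ Commute x v) (hy : Commute y u ∧ Commute y v)
    (hx2 : x ^ 2 = z) (hy2 : y ^ 2 = z) (hu2 : u ^ 2 = 1) (hv1 : v ^ 2 ≠ 1) (hvz : v ^ 2 ≠ z)
    (htop : ∀ g, ∃ m ∈ Subgroup.closure {x, y} ⊔ Subgroup.closure {u, v},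
      g * m ∈ Subgroup.center G) :
    ∃ (n : ℕ) (θ : commutator (QuaternionGroup 2) ≃* commutator (GroupP 2 2 1)),
      Nonempty (G ≃* ElemAbelianTwo n ×
        CentralProduct (QuaternionGroup 2) (GroupP 2 2 1) θ) := by
  have hv22 : (v ^ 2) ^ 2 = 1 := hZ _ (D.pow_mem_center v)
  have hv4 : v ^ 4 = 1 := by rw [show 4 = 2 * 2 from rfl, pow_mul, hv22]
  have hzc := Subgroup.mem_center_iff.1 D.mem_center
  let g : GroupP 2 2 1 →* G :=
    GroupP.lift hv4 D.sq_eq_one hu2 (hzc v) (hzc u).symm (D.mul_eq_of_not_commute huv)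
  have hgA : g GroupP.genA = v := GroupP.lift_genA ..
  have hgB : g GroupP.genB = z := GroupP.lift_genB ..
  have hgC : g GroupP.genC = u := GroupP.lift_genC ..
  refine D.exists_mulEquiv_prod_quaternion hZ hxy hx hy hx2 hy2 htop
    GroupP.commutatorsMemZPowers GroupP.mem_or_exists_not_commute
    ⟨_, _, GroupP.not_commute_genA_genC⟩ g ?_ hgB ?_ ?_
  · rw [GroupP.range_eq_closure, hgA, hgC, Set.pair_comm]
  · rw [MonoidHom.map_closure, Set.image_pair, map_pow, hgA, hgB, Subgroup.closure_le]
    rintro _ (rfl | rfl)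
    · exact D.pow_mem_center v
    · exact D.mem_center
  · intro b hb hb1
    obtain ⟨i, j, rfl⟩ := exists_eq_zpow_mul_zpow (GroupP.commute_genA_genB.pow_left 2) hb
    have hA2 : (GroupP.genA ^ 2) ^ 2 = 1 := by rw [← pow_mul]; exact GroupP.genA_pow
    rw [map_mul, map_zpow, map_zpow, map_pow, hgA, hgB] at hb1
    -- `v ^ 2` and `z` are independent involutions, so only even exponents give the identity.
    rw [zpow_eq_ite_of_sq_eq_one hv22, zpow_eq_ite_of_sq_eq_one D.sq_eq_one] at hb1
    rw [zpow_eq_ite_of_sq_eq_one hA2, zpow_eq_ite_of_sq_eq_one GroupP.genB_sq]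
    split_ifs at hb1 ⊢
    · exact one_mul 1
    · exact absurd ((one_mul z).symm.trans hb1) D.ne_one
    · exact absurd ((mul_one _).symm.trans hb1) hv1
    · refine absurd ?_ hvz
      rw [eq_inv_of_mul_eq_one_left hb1, inv_eq_iff_mul_eq_one, ← sq, D.sq_eq_one]

end CommutatorsMemZPowers

theorem exists_mulEquiv_of_index_center_ne {G : Type*} [Group G] [Finite G] (hG : IsPGroup 2 G)
    (hebr : ebr 2 G = 1) (hsbr : sbr 2 G = 1) (hZ : (Subgroup.center G).index ≠ 2 ^ 2) :
    (∃ (n : ℕ) (θ : commutator (QuaternionGroup 2) ≃* commutator (DihedralGroup 4)),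
      Nonempty (G ≃* ElemAbelianTwo n ×
        CentralProduct (QuaternionGroup 2) (DihedralGroup 4) θ)) ∨
    (∃ (n : ℕ) (θ : commutator (QuaternionGroup 2) ≃* commutator (GroupP 2 2 1)),
      Nonempty (G ≃* ElemAbelianTwo n ×
        CentralProduct (QuaternionGroup 2) (GroupP 2 2 1) θ)) := by
  obtain ⟨z, D⟩ := exists_commutatorsMemZPowers hG hebr
  have hZ2 : ∀ t ∈ Subgroup.center G, t ^ 2 = 1 := fun t => center_sq_eq_one hG hebr hsbr hZ D
  obtain ⟨x, y, u, v, hxy, huv, hx, hy, hx2, hy2, hu2, htop⟩ :=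
    D.exists_generators (exists_not_commute hebr)
      (fun s t => exists_notMem_center_commute hG hebr hZ)
      (fun x y g => sq_eq_or_of_commute hG hebr hsbr D hZ2)
  by_cases hvz : v ^ 2 = z
  · exact .inl (D.exists_mulEquiv_prod_quaternion_dihedral hZ2 hxy huv hx hy hx2 hy2 hu2 hvz htop)
  by_cases hv1 : v ^ 2 = 1
  · left
    have hcl : Subgroup.closure {u, v} ≤ Subgroup.closure {u, u * v} := by
      have hu : u ∈ Subgroup.closure {u, u * v} := Subgroup.subset_closure (by simp)
      have huv : u * v ∈ Subgroup.closure {u, u * v} := Subgroup.subset_closure (by simp)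
      rw [Subgroup.closure_le]
      rintro _ (rfl | rfl)
      · exact hu
      · exact (Subgroup.mul_mem_cancel_left _ hu).1 huv
    -- When `u` and `v` are both involutions, `u * v` squares to `z` and replaces `v` as the
    -- rotation of order four.
    refine D.exists_mulEquiv_prod_quaternion_dihedral hZ2 hxy (u := u) (v := u * v)
      (fun h => huv ((commute_mul_iff_of_commute_left (.refl u)).1 h.symm).symm)
      ⟨hx.1, hx.1.mul_right hx.2⟩ ⟨hy.1, hy.1.mul_right hy.2⟩ hx2 hy2 hu2 ?_ fun g => ?_
    · rw [D.mul_sq_of_not_commute huv, hu2, hv1, mul_one, mul_one]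
    · obtain ⟨m, hm, h⟩ := htop g
      exact ⟨m, sup_le_sup_left hcl _ hm, h⟩
  · exact .inr (D.exists_mulEquiv_prod_quaternion_groupP hZ2 hxy huv hx hy hx2 hy2 hu2 hv1 hvz htop)

theorem mainTheorem4 (p : ℕ) [Fact p.Prime] (G : Type*) [Group G] [Finite G]
    (hG : IsPGroup p G) (hebr : ebr p G = 1) (hsbr : sbr p G = 1) :
    (Subgroup.center G).index = p ^ 2 ↔
      ¬ (p = 2 ∧
        ((∃ (n : ℕ) (θ : commutator (QuaternionGroup 2) ≃* commutator (DihedralGroup 4)),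
            Nonempty (G ≃* ElemAbelianTwo n ×
              CentralProduct (QuaternionGroup 2) (DihedralGroup 4) θ)) ∨
          (∃ (n : ℕ) (θ : commutator (QuaternionGroup 2) ≃* commutator (GroupP 2 2 1)),
            Nonempty (G ≃* ElemAbelianTwo n ×
              CentralProduct (QuaternionGroup 2) (GroupP 2 2 1) θ)))) := by
  constructor
  · rintro hZ ⟨rfl, ⟨n, θ, ⟨e⟩⟩ | ⟨n, θ, ⟨e⟩⟩⟩
    · have := eight_le_index_center_of_mulEquiv QuaternionGroup.commutatorsMemZPowers
        DihedralGroup.commutatorsMemZPowers QuaternionGroup.exists_not_commute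
        DihedralGroup.exists_not_commute θ e
      omega
    · have := eight_le_index_center_of_mulEquiv QuaternionGroup.commutatorsMemZPowers
        GroupP.commutatorsMemZPowers QuaternionGroup.exists_not_commute
        ⟨_, _, GroupP.not_commute_genA_genC⟩ θ e
      omega
  · intro h
    by_contra hZ
    obtain ⟨z, D⟩ := exists_commutatorsMemZPowers hG hebr
    obtain rfl := eq_two_of_index_center_ne hG hebr hsbr hZ D
    exact h ⟨rfl, exists_mulEquiv_of_index_center_ne hG hebr hsbr hZ⟩
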